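/- Let $\mathcal H(\mathbb C^d)$ be the space of Hermitian operators on $\mathbb C^d$. A discrete POVM on $\mathbb C^d$ is a family $\mathrm M=(M_i)_{1\le i\le n}$ of positive semidefinite operators with $\sum_i M_i=\mathrm{Id}$; its distinguishability norm is $\|\Delta\|_{\mathrm M}=\sum_{i=1}^n|\operatorname{tr}(\Delta M_i)|$ for $\Delta\in\mathcal H(\mathbb C^d)$. The distinguishability norm of the uniform POVM $\mathrm U_d$ is $\|\Delta\|_{\mathrm U_d}=d\,\mathbb E\,|\langle\psi|\Delta|\psi\rangle|$, where $\psi$ is uniformly (Haar) distributed on the unit sphere of $\mathbb C^d$. There is an absolute constant $C>0$, and for every $0<\varepsilon<1$ there is a constant $c(\varepsilon)>0$ depending only on $\varepsilon$, such that the following holds for all integers $d\ge 1$ and $n$ with $$n\ \ge\ C\,\varepsilon^{-2}\,\max(1,|\log\varepsilon|)\,d^2 .$$ Let $\psi_1,\dots,\psi_n$ be independent random vectors, uniformly distributed on the unit sphere of $\mathbb C^d$, and let $P_i=|\psi_i\rangle\langle\psi_i|$, $S=P_1+\dots+P_n$ and $\mathrm M=(S^{-1/2}P_iS^{-1/2})_{1\le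 i\le n}$. Then, except on an event of probability less than $\exp(-c(\varepsilon)d)$, $S$ is invertible, so that $\mathrm M$ is a POVM, and $$(1-\varepsilon)\|\Delta\|_{\mathrm U_d}\ \le\ \|\Delta\|_{\mathrm M}\ \le\ (1+\varepsilon)\|\Delta\|_{\mathrm U_d}\qquad\text{for every }\Delta\in\mathcal H(\mathbb C^d).$$ -/

import Mathlib

noncomputable section

namespace RandomPOVM

open MeasureTheory
open scoped MatrixOrder ComplexOrder

/-- The unit sphere of `ℂ^d` (with its Hermitian norm). -/
abbrev UnitSphere (d : ℕ) : Type := Metric.sphere (0 : EuclideanSpace ℂ (Fin d)) 1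

/-- The uniform (Haar) probability measure on the unit sphere of `ℂ^d`: the surface measure induced
by Lebesgue measure on `ℂ^d = ℝ^{2d}`, normalized to total mass `1`. -/
def uniformSphere (d : ℕ) : Measure (UnitSphere d) :=
  ((volume : Measure (EuclideanSpace ℂ (Fin d))).toSphere Set.univ)⁻¹ •
    (volume : Measure (EuclideanSpace ℂ (Fin d))).toSphere

/-- The coordinates of a unit vector. -/
def coords {d : ℕ} (ψ : UnitSphere d) : Fin d → ℂ := (ψ : EuclideanSpace ℂ (Fin d)).ofLp

/-- The rank-one projection `|ψ⟩⟨ψ|`. -/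
def proj {d : ℕ} (ψ : UnitSphere d) : Matrix (Fin d) (Fin d) ℂ :=
  Matrix.vecMulVec (coords ψ) (star (coords ψ))

/-- `M = (M_i)` is a discrete POVM: positive operators that sum to the identity. -/
structure IsDiscretePOVM {d n : ℕ} (M : Fin n → Matrix (Fin d) (Fin d) ℂ) : Prop where
  posSemidef : ∀ i, (M i).PosSemidef
  sum_eq_one : ∑ i, M i = 1

/-- The distinguishability norm of a discrete POVM, `‖Δ‖_M = ∑ i, |tr (Δ M_i)|`. -/
def povmNorm {d n : ℕ} (M : Fin n → Matrix (Fin d) (Fin d) ℂ) (Δ : Matrix (Fin d) (Fin d) ℂ) : ℝ :=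
  ∑ i, ‖(Δ * M i).trace‖

/-- The distinguishability norm of the uniform POVM, `‖Δ‖_{U_d} = d 𝔼 |⟨ψ|Δ|ψ⟩|`, where `ψ` is a
Haar-distributed unit vector. -/
def uniformNorm (d : ℕ) (Δ : Matrix (Fin d) (Fin d) ℂ) : ℝ :=
  d * ∫ ψ : UnitSphere d, ‖star (coords ψ) ⬝ᵥ Δ.mulVec (coords ψ)‖ ∂(uniformSphere d)

/-- `S = ∑ i, |ψ_i⟩⟨ψ_i|`. -/
def frameSum {d n : ℕ} (ψ : Fin n → UnitSphere d) : Matrix (Fin d) (Fin d) ℂ :=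
  ∑ i, proj (ψ i)

/-- The family `(S^{-1/2} P_i S^{-1/2})_i` with `P_i = |ψ_i⟩⟨ψ_i|` and `S = ∑ i, P_i`. It is a POVM
exactly when `S` is invertible; otherwise the matrix inverse is `0` by convention. -/
def randomPOVM {d n : ℕ} (ψ : Fin n → UnitSphere d) (i : Fin n) : Matrix (Fin d) (Fin d) ℂ :=
  (CFC.sqrt (frameSum ψ))⁻¹ * proj (ψ i) * (CFC.sqrt (frameSum ψ))⁻¹

end RandomPOVM

end

/-!
A standard complex Gaussian vector `z` is an independent radius `r`, with `𝔼 r² = d`, times a Haar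
unit vector `ψ`. After diagonalizing a Hermitian matrix `A` with eigenvalues `l_j`, `⟨z|A|z⟩` is
distributed as `∑ j, l_j |z_j|²` with independent exponential variables `|z_j|²`. So its second
moment is `(tr A)² + ‖A‖²`, `‖A‖` being the Frobenius norm, and this quantity controls its
exponential moments. By Jensen's inequality in `r`, it also controls those of `d ⟨ψ|A|ψ⟩`.

A second moment together with an exponential moment bounds a first moment from below. Hence the norm
of the uniform POVM is equivalent, up to absolute constants, to `|tr A| + ‖A‖`, and `d ⟨ψ|A|ψ⟩` is
subexponential, uniformly over the unit ball of that norm. Bernstein's inequality and a union bound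
over a `δ`-net of this ball, which has real dimension `2 d²`, show that outside an event of small
probability the empirical family `((d / n) P_i)_i` has a norm within `O(δ)` of the uniform one and
a sum `T` with `|tr (Δ (T - 1))| = O(δ ‖Δ‖)` for trace-zero `Δ`. As `tr T = d`, this gives
`‖T - 1‖ = O(δ)`. Then `T^{-1/2}` is also `O(δ)`-close to `1`, and passing from `(d / n) P_i` to
`T^{-1/2} (d / n) P_i T^{-1/2} = S^{-1/2} P_i S^{-1/2}` changes the norm by a factor `1 + O(δ)`.
-/

noncomputable section

namespace RandomPOVM

open MeasureTheory ProbabilityTheory Real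
open scoped MatrixOrder ComplexOrder ENNReal

section Polar

theorem map_withDensity_comp {α β : Type*} [MeasurableSpace α] [MeasurableSpace β]
    {μ : Measure α} {g : α → β} (hg : Measurable g) {f : β → ℝ≥0∞} (hf : Measurable f) :
    (μ.withDensity (f ∘ g)).map g = (μ.map g).withDensity f := by
  ext s hs
  rw [Measure.map_apply hg hs, withDensity_apply _ (hg hs), withDensity_apply _ hs,
    Measure.restrict_map hg hs, lintegral_map hf hg]
  rfl

variable {E : Type*} [NormedAddCommGroup E] [NormedSpace ℝ E] [MeasurableSpace E] [BorelSpace E]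
  [FiniteDimensional ℝ E] [Nontrivial E]

theorem map_toSphere_prod_volumeIoiPow (μ : Measure E) [μ.IsAddHaarMeasure] :
    (μ.toSphere.prod (.volumeIoiPow (Module.finrank ℝ E - 1))).map
      (fun p => (p.2 : ℝ) • (p.1 : E)) = μ := by
  have hsymm : MeasurePreserving (homeomorphUnitSphereProd E).symm
      (μ.toSphere.prod (.volumeIoiPow (Module.finrank ℝ E - 1))) (μ.comap Subtype.val) :=
    μ.measurePreserving_homeomorphUnitSphereProd.symm
      (homeomorphUnitSphereProd E).toMeasurableEquiv
  have hpolar : (fun p : Metric.sphere (0 : E) 1 × Set.Ioi (0 : ℝ) => (p.2 : ℝ) • (p.1 : E))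
      = Subtype.val ∘ (homeomorphUnitSphereProd E).symm := by
    ext p
    simp only [Function.comp_apply, homeomorphUnitSphereProd_symm_apply_coe]
  rw [hpolar, ← Measure.map_map measurable_subtype_coe hsymm.measurable, hsymm.map_eq,
    (MeasurableEmbedding.subtype_coe (measurableSet_singleton (0 : E)).compl).map_comap,
    Subtype.range_coe, restrict_compl_singleton]

theorem map_toSphere_prod_withDensity (μ : Measure E) [μ.IsAddHaarMeasure] {w : ℝ → ℝ≥0∞}
    (hw : Measurable w) :
    (μ.toSphere.prod ((Measure.volumeIoiPow (Module.finrank ℝ E - 1)).withDensity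
      fun r => w r)).map (fun p => (p.2 : ℝ) • (p.1 : E)) = μ.withDensity fun z => w ‖z‖ := by
  have hnorm : (fun p : Metric.sphere (0 : E) 1 × Set.Ioi (0 : ℝ) => w p.2)
      = (fun z : E => w ‖z‖) ∘ fun p => (p.2 : ℝ) • (p.1 : E) := by
    ext p
    rw [Function.comp_apply, norm_smul, norm_eq_of_mem_sphere, mul_one, Real.norm_eq_abs,
      abs_of_pos p.2.2]
  rw [prod_withDensity_right (by fun_prop), hnorm,
    map_withDensity_comp (by fun_prop) (by fun_prop), map_toSphere_prod_volumeIoiPow]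

theorem exists_map_smul_eq_withDensity_norm (μ : Measure E) [μ.IsAddHaarMeasure] {w : ℝ → ℝ≥0∞}
    (hw : Measurable w) [IsProbabilityMeasure (μ.withDensity fun z => w ‖z‖)] :
    ∃ ρ : Measure (Set.Ioi (0 : ℝ)), IsProbabilityMeasure ρ ∧
      (((μ.toSphere Set.univ)⁻¹ • μ.toSphere).prod ρ).map (fun p => (p.2 : ℝ) • (p.1 : E))
        = μ.withDensity fun z => w ‖z‖ := by
  set a := μ.toSphere Set.univ
  have ha : a ≠ 0 := Measure.measure_univ_ne_zero.2 (Measure.toSphere_ne_zero μ)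
  have ha' : a ≠ ∞ := measure_ne_top _ _
  set ρ := (Measure.volumeIoiPow (Module.finrank ℝ E - 1)).withDensity fun r => w r
  have hmap := map_toSphere_prod_withDensity μ hw
  have hρ : IsProbabilityMeasure (a • ρ) := by
    constructor
    rw [Measure.smul_apply, smul_eq_mul, ← Measure.prod_prod, Set.univ_prod_univ]
    simpa only [Measure.map_apply (show Measurable fun p : Metric.sphere (0 : E) 1 ×
      Set.Ioi (0 : ℝ) => (p.2 : ℝ) • (p.1 : E) by fun_prop) MeasurableSet.univ, Set.preimage_univ,
      measure_univ] using congrArg (· Set.univ) hmap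
  refine ⟨a • ρ, hρ, ?_⟩
  rw [Measure.prod_smul_right, Measure.prod_smul_left, smul_smul, ENNReal.mul_inv_cancel ha ha',
    one_smul, hmap]

end Polar

section Tilted

theorem map_tilted_comp {α β : Type*} [MeasurableSpace α] [MeasurableSpace β] {μ : Measure α}
    {g : α → β} (hg : Measurable g) {f : β → ℝ} (hf : Measurable f) :
    (μ.tilted (f ∘ g)).map g = (μ.map g).tilted f := by
  rw [Measure.tilted, Measure.tilted,
    integral_map hg.aemeasurable (by fun_prop : AEStronglyMeasurable (fun x => exp (f x)) _),
    ← map_withDensity_comp hg (by fun_prop)]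
  rfl

theorem tilted_smul_measure {α : Type*} [MeasurableSpace α] (μ : Measure α) (f : α → ℝ)
    {c : ℝ≥0∞} (hc : c ≠ 0) (hc' : c ≠ ∞) : (c • μ).tilted f = μ.tilted f := by
  ext s hs
  rw [tilted_apply_eq_ofReal_integral' _ hs, tilted_apply_eq_ofReal_integral' _ hs,
    integral_smul_measure, Measure.restrict_smul, integral_smul_measure, smul_eq_mul, smul_eq_mul,
    integral_div, integral_div, ← mul_div_assoc,
    mul_div_mul_left _ _ (ENNReal.toReal_ne_zero.2 ⟨hc, hc'⟩)]

theorem tilted_pi {ι : Type*} [Fintype ι] {α : ι → Type*} [∀ i, MeasurableSpace (α i)]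
    (μ : ∀ i, Measure (α i)) [∀ i, SigmaFinite (μ i)] (f : ∀ i, α i → ℝ) :
    (Measure.pi μ).tilted (fun x => ∑ i, f i (x i)) = .pi fun i => (μ i).tilted (f i) := by
  refine (Measure.pi_eq fun s hs => ?_).symm
  simp only [tilted_apply_eq_ofReal_integral' _ (hs _),
    tilted_apply_eq_ofReal_integral' _ (.univ_pi hs)]
  rw [← ENNReal.ofReal_prod_of_nonneg
      (fun i _ => integral_nonneg fun x => div_nonneg (exp_pos _).le
        (integral_nonneg fun y => (exp_pos _).le)),
    Measure.restrict_pi_pi]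
  simp only [integral_div, exp_sum, Finset.prod_div_distrib,
    integral_fintype_prod_eq_prod (fun i x => exp (f i x))]

end Tilted

section Gaussian

/-- The standard complex Gaussian law on `ℂ`, with density proportional to `exp (-‖w‖ ^ 2)`. -/
def complexNormal : Measure ℂ := volume.tilted fun w => -‖w‖ ^ 2

theorem integral_norm_sq_pow_mul_exp (k : ℕ) {b : ℝ} (hb : 0 < b) :
    ∫ w : ℂ, exp (-(b * ‖w‖ ^ 2)) * (‖w‖ ^ 2) ^ k = π * (k.factorial / b ^ (k + 1)) := by
  have h := Complex.integral_rpow_mul_exp_neg_mul_rpow (p := 2) (q := (2 * k : ℕ)) (b := b)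
    (by norm_num) (by linarith [Nat.cast_nonneg (α := ℝ) (2 * k)]) hb
  have hexp : -(((2 * k : ℕ) : ℝ) + 2) / 2 = -((k + 1 : ℕ) : ℝ) := by push_cast; ring
  have hGamma : (((2 * k : ℕ) : ℝ) + 2) / 2 = k + 1 := by push_cast; ring
  simp only [hexp, hGamma, rpow_natCast, rpow_neg hb.le, rpow_ofNat, Gamma_nat_eq_factorial] at h
  calc ∫ w : ℂ, exp (-(b * ‖w‖ ^ 2)) * (‖w‖ ^ 2) ^ k
      = ∫ w : ℂ, ‖w‖ ^ (2 * k) * exp (-b * ‖w‖ ^ 2) := by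
        congr 1; ext w; rw [mul_comm, pow_mul, neg_mul]
    _ = π * (k.factorial / b ^ (k + 1)) := by rw [h]; field_simp

theorem integrable_exp_neg_norm_sq : Integrable fun w : ℂ => exp (-‖w‖ ^ 2) := by
  refine .of_integral_ne_zero ?_
  have h := integral_norm_sq_pow_mul_exp 0 one_pos
  simp only [pow_zero, mul_one, one_mul] at h
  simp [h, pi_ne_zero]

theorem integral_exp_neg_norm_sq : ∫ w : ℂ, exp (-‖w‖ ^ 2) = π := by
  simpa using integral_norm_sq_pow_mul_exp 0 one_pos

instance : IsProbabilityMeasure complexNormal :=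
  isProbabilityMeasure_tilted integrable_exp_neg_norm_sq

theorem integral_norm_sq_pow (k : ℕ) : ∫ w, (‖w‖ ^ 2) ^ k ∂complexNormal = k.factorial := by
  have h := integral_norm_sq_pow_mul_exp k one_pos
  simp only [one_mul, one_pow, div_one] at h
  simp_rw [complexNormal, integral_tilted, integral_exp_neg_norm_sq, smul_eq_mul,
    div_mul_eq_mul_div, integral_div, h, mul_div_cancel_left₀ _ pi_ne_zero]

theorem integral_exp_mul_norm_sq {l : ℝ} (hl : l < 1) :
    ∫ w, exp (l * ‖w‖ ^ 2) ∂complexNormal = (1 - l)⁻¹ := by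
  have h := integral_norm_sq_pow_mul_exp 0 (sub_pos.2 hl)
  have hsum : ∀ w : ℂ, -‖w‖ ^ 2 + l * ‖w‖ ^ 2 = -((1 - l) * ‖w‖ ^ 2) := fun w => by ring
  simp only [pow_zero, mul_one, Nat.factorial_zero, Nat.cast_one, zero_add, pow_one] at h
  simp only [complexNormal, integral_exp_tilted, Pi.add_apply, hsum, h, integral_exp_neg_norm_sq,
    mul_div_cancel_left₀ _ pi_ne_zero, one_div]

theorem integrable_exp_mul_norm_sq {l : ℝ} (hl : l < 1) :
    Integrable (fun w => exp (l * ‖w‖ ^ 2)) complexNormal :=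
  .of_integral_ne_zero <| by
    rw [integral_exp_mul_norm_sq hl]; exact inv_ne_zero (sub_pos.2 hl).ne'

theorem memLp_norm_sq : MemLp (fun w : ℂ => ‖w‖ ^ 2) 2 complexNormal := by
  refine (memLp_two_iff_integrable_sq (by fun_prop)).2 (.of_integral_ne_zero ?_)
  rw [integral_norm_sq_pow]
  positivity

theorem variance_norm_sq : Var[fun w : ℂ => ‖w‖ ^ 2; complexNormal] = 1 := by
  have h1 := integral_norm_sq_pow 1
  simp only [pow_one] at h1
  rw [variance_eq_sub memLp_norm_sq, h1]
  simp only [Pi.pow_apply, integral_norm_sq_pow]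
  norm_num [Nat.factorial]

variable {E ι : Type*} [NormedAddCommGroup E] [NormedSpace ℝ E] [MeasurableSpace E] [BorelSpace E]
  [Fintype ι]

theorem map_tilted_neg_norm_sq (μ : Measure E) [μ.IsAddHaarMeasure] (L : E ≃L[ℝ] (ι → ℂ))
    (hL : ∀ z, ∑ i, ‖L z i‖ ^ 2 = ‖z‖ ^ 2) :
    (μ.tilted fun z => -‖z‖ ^ 2).map L = .pi fun _ => complexNormal := by
  have hmap : (μ.map L).IsAddHaarMeasure := L.isAddHaarMeasure_map μ
  have hscalar := Measure.isAddLeftInvariant_eq_smul (μ.map L) (volume : Measure (ι → ℂ))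
  set c := (μ.map L).addHaarScalarFactor (volume : Measure (ι → ℂ))
  have hc : c ≠ 0 := by
    rintro hc
    rw [hc, zero_smul] at hscalar
    exact NeZero.ne _ hscalar
  have hnorm : (fun z => -‖z‖ ^ 2) = (fun x : ι → ℂ => ∑ i, -‖x i‖ ^ 2) ∘ L := by
    ext z
    rw [Function.comp_apply, Finset.sum_neg_distrib, hL]
  rw [hnorm, map_tilted_comp L.continuous.measurable (by fun_prop), hscalar,
    ← Measure.coe_nnreal_smul, tilted_smul_measure _ _ (by exact_mod_cast hc) ENNReal.coe_ne_top,
    volume_pi, tilted_pi _ fun _ w => -‖w‖ ^ 2]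
  rfl

end Gaussian

section DiagonalForm

variable {ι : Type*} [Fintype ι] (l : ι → ℝ)

theorem memLp_diagForm_term (i : ι) : MemLp (fun x : ι → ℂ => l i * ‖x i‖ ^ 2) 2
    (.pi fun _ => complexNormal) :=
  (memLp_norm_sq.const_mul (l i)).comp_measurePreserving (measurePreserving_eval _ i)

theorem memLp_diagForm : MemLp (fun x : ι → ℂ => ∑ i, l i * ‖x i‖ ^ 2) 2
    (.pi fun _ => complexNormal) :=
  memLp_finsetSum _ fun i _ => memLp_diagForm_term l i

theorem integral_diagForm :
    ∫ x : ι → ℂ, ∑ i, l i * ‖x i‖ ^ 2 ∂(.pi fun _ => complexNormal) = ∑ i, l i := by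
  rw [integral_finsetSum _ fun i _ => (memLp_diagForm_term l i).integrable one_le_two]
  refine Finset.sum_congr rfl fun i _ => ?_
  have h := integral_norm_sq_pow 1
  simp only [pow_one, Nat.factorial_one, Nat.cast_one] at h
  rw [integral_const_mul, integral_comp_eval (μ := fun _ => complexNormal)
    (f := fun w : ℂ => ‖w‖ ^ 2) (by fun_prop), h, mul_one]

theorem variance_diagForm :
    Var[fun x : ι → ℂ => ∑ i, l i * ‖x i‖ ^ 2; .pi fun _ => complexNormal] = ∑ i, l i ^ 2 := by
  rw [← Finset.sum_fn, IndepFun.variance_sum (fun i _ => memLp_diagForm_term l i)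
    fun i _ j _ hij => (iIndepFun_pi (μ := fun _ => complexNormal)
      (X := fun i w => l i * ‖w‖ ^ 2) fun i => by fun_prop).indepFun hij]
  refine Finset.sum_congr rfl fun i _ => ?_
  rw [variance_const_mul,
    (measurePreserving_eval (fun _ : ι => complexNormal) i).variance_fun_comp
      (f := fun w : ℂ => ‖w‖ ^ 2) (by fun_prop), variance_norm_sq, mul_one]

theorem integral_diagForm_sq :
    ∫ x : ι → ℂ, (∑ i, l i * ‖x i‖ ^ 2) ^ 2 ∂(.pi fun _ => complexNormal)
      = (∑ i, l i) ^ 2 + ∑ i, l i ^ 2 := by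
  have h := variance_eq_sub (memLp_diagForm l)
  rw [variance_diagForm, integral_diagForm] at h
  rw [h, add_sub_cancel]
  rfl

theorem integral_exp_diagForm (hl : ∀ i, l i < 1) :
    ∫ x : ι → ℂ, exp (∑ i, l i * ‖x i‖ ^ 2) ∂(.pi fun _ => complexNormal)
      = ∏ i, (1 - l i)⁻¹ := by
  simp_rw [exp_sum, integral_fintype_prod_eq_prod (fun i w => exp (l i * ‖w‖ ^ 2)),
    integral_exp_mul_norm_sq (hl _)]

theorem integrable_exp_diagForm (hl : ∀ i, l i < 1) :
    Integrable (fun x : ι → ℂ => exp (∑ i, l i * ‖x i‖ ^ 2)) (.pi fun _ => complexNormal) := by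
  simp_rw [exp_sum]
  exact .fintype_prod fun i => integrable_exp_mul_norm_sq (hl i)

theorem inv_one_sub_le_exp {x : ℝ} (hx : x ≤ 1 / 2) : (1 - x)⁻¹ ≤ exp (x + x ^ 2) := by
  rw [inv_le_iff_one_le_mul₀ (by linarith)]
  rcases le_total x 0 with hneg | hpos
  · nlinarith [add_one_le_exp (x + x ^ 2), pow_nonneg (neg_nonneg.2 hneg) 3]
  · have hfactor : 0 ≤ (1 - x) * (1 + x) ^ 2 - 2 * x := by nlinarith
    calc (1 : ℝ) ≤ 1 + x ^ 2 / 2 * ((1 - x) * (1 + x) ^ 2 - 2 * x) :=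
          le_add_of_nonneg_right (by positivity)
      _ = (1 + (x + x ^ 2) + (x + x ^ 2) ^ 2 / 2) * (1 - x) := by ring
      _ ≤ exp (x + x ^ 2) * (1 - x) :=
          mul_le_mul_of_nonneg_right (quadratic_le_exp_of_nonneg (by positivity)) (by linarith)

theorem exp_half_le_two : exp (1 / 2) ≤ 2 := by
  have hsq : exp (1 / 2) ^ 2 = exp 1 := by rw [← exp_nat_mul]; norm_num
  nlinarith [exp_one_lt_d9, exp_pos (1 / 2)]

variable {l}

theorem integrable_and_integral_exp_diagForm_le_two
    (hl : (∑ i, l i) ^ 2 + ∑ i, l i ^ 2 ≤ 1 / 4) :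
    Integrable (fun x : ι → ℂ => exp (∑ i, l i * ‖x i‖ ^ 2)) (.pi fun _ => complexNormal) ∧
      ∫ x : ι → ℂ, exp (∑ i, l i * ‖x i‖ ^ 2) ∂(.pi fun _ => complexNormal) ≤ 2 := by
  have hle : ∀ i, l i ≤ 1 / 2 := fun i => by
    have := Finset.single_le_sum (f := fun i => l i ^ 2) (fun i _ => sq_nonneg (l i))
      (Finset.mem_univ i)
    nlinarith [sq_nonneg (∑ i, l i)]
  have hlt : ∀ i, l i < 1 := fun i => (hle i).trans_lt (by norm_num)
  refine ⟨integrable_exp_diagForm l hlt, ?_⟩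
  calc ∫ x : ι → ℂ, exp (∑ i, l i * ‖x i‖ ^ 2) ∂(.pi fun _ => complexNormal)
      = ∏ i, (1 - l i)⁻¹ := integral_exp_diagForm l hlt
    _ ≤ ∏ i, exp (l i + l i ^ 2) :=
        Finset.prod_le_prod (fun i _ => inv_nonneg.2 (by linarith [hle i]))
          fun i _ => inv_one_sub_le_exp (hle i)
    _ = exp (∑ i, l i + ∑ i, l i ^ 2) := by rw [← exp_sum, Finset.sum_add_distrib]
    _ ≤ exp (1 / 2) := exp_le_exp.2 (by nlinarith [sq_nonneg (∑ i, l i - 1 / 2)])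
    _ ≤ 2 := exp_half_le_two

theorem integrable_and_integral_cosh_diagForm_le_two (hl : (∑ i, l i) ^ 2 + ∑ i, l i ^ 2 ≤ 1) :
    Integrable (fun x : ι → ℂ => cosh ((∑ i, l i * ‖x i‖ ^ 2) / 2)) (.pi fun _ => complexNormal) ∧
      ∫ x : ι → ℂ, cosh ((∑ i, l i * ‖x i‖ ^ 2) / 2) ∂(.pi fun _ => complexNormal) ≤ 2 := by
  have hscale : ∀ c : ℝ, c ^ 2 = 1 / 4 → (∑ i, c * l i) ^ 2 + ∑ i, (c * l i) ^ 2 ≤ 1 / 4 := by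
    intro c hc
    simp only [mul_pow, ← Finset.mul_sum, hc]
    linarith
  obtain ⟨hpos, hpos'⟩ :=
    integrable_and_integral_exp_diagForm_le_two (hscale (1 / 2) (by norm_num))
  obtain ⟨hneg, hneg'⟩ :=
    integrable_and_integral_exp_diagForm_le_two (hscale (-1 / 2) (by norm_num))
  have hcosh : ∀ x : ι → ℂ, cosh ((∑ i, l i * ‖x i‖ ^ 2) / 2) =
      (exp (∑ i, 1 / 2 * l i * ‖x i‖ ^ 2) + exp (∑ i, -1 / 2 * l i * ‖x i‖ ^ 2)) / 2 := by
    intro x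
    simp only [cosh_eq, mul_assoc, ← Finset.mul_sum]
    ring_nf
  simp only [hcosh]
  refine ⟨(hpos.add hneg).div_const 2, ?_⟩
  rw [integral_div, integral_add hpos hneg]
  linarith

end DiagonalForm

section Frobenius

open Matrix
open scoped Matrix.Norms.Frobenius

variable {m n 𝕜 : Type*} [Fintype m] [Fintype n] [RCLike 𝕜]

theorem frobenius_norm_sq (A : Matrix m n 𝕜) : ‖A‖ ^ 2 = ∑ i, ∑ j, ‖A i j‖ ^ 2 := by
  rw [frobenius_norm_def, ← Real.rpow_natCast, ← Real.rpow_mul (by positivity)]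
  norm_num

theorem trace_mul_conjTranspose_self (A : Matrix m n 𝕜) :
    (A * Aᴴ).trace = ((‖A‖ ^ 2 : ℝ) : 𝕜) := by
  simp only [trace, diag_apply, mul_apply, conjTranspose_apply, frobenius_norm_sq,
    RCLike.star_def, RCLike.mul_conj, RCLike.ofReal_sum, RCLike.ofReal_pow]

theorem norm_trace_mul_le (A : Matrix m n 𝕜) (B : Matrix n m 𝕜) :
    ‖(A * B).trace‖ ≤ ‖A‖ * ‖B‖ := by
  have hsum : ‖(A * B).trace‖ ≤ ∑ p : m × n, ‖A p.1 p.2‖ * ‖B p.2 p.1‖ := by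
    simp only [trace, diag_apply, mul_apply, ← norm_mul]
    rw [← Fintype.sum_prod_type']
    exact norm_sum_le _ _
  have hcs := Finset.sum_mul_sq_le_sq_mul_sq Finset.univ (fun p : m × n => ‖A p.1 p.2‖)
    fun p => ‖B p.2 p.1‖
  rw [Fintype.sum_prod_type' (fun i j => ‖A i j‖ ^ 2),
    Fintype.sum_prod_type' (fun i j => ‖B j i‖ ^ 2), Finset.sum_comm (f := fun i j => ‖B j i‖ ^ 2),
    ← frobenius_norm_sq, ← frobenius_norm_sq, ← mul_pow] at hcs
  exact hsum.trans (abs_le_of_sq_le_sq' hcs (by positivity)).2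

variable [DecidableEq n]

theorem norm_sub_one_le_norm_mul_self_sub_one {A : Matrix n n 𝕜} (hA : A.PosSemidef) :
    ‖A - 1‖ ≤ ‖A * A - 1‖ := by
  set B := A - 1 with hB
  have hBstar : Bᴴ = B := (hA.isHermitian.sub isHermitian_one).eq
  have hfactor : A * A - 1 = B + B * A := by rw [hB]; noncomm_ring
  have hexpand : (B + B * A) * (B + B * A)ᴴ
      = B * Bᴴ + B * A * (B * A)ᴴ + 2 • (B * A * Bᴴ) := by
    rw [conjTranspose_add, conjTranspose_mul, hA.isHermitian.eq, hBstar]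
    noncomm_ring
  have hpos : 0 ≤ RCLike.re (B * A * Bᴴ).trace :=
    (RCLike.le_iff_re_im.1 (hA.mul_mul_conjTranspose_same B).trace_nonneg).1.trans_eq' (by simp)
  have htrace := congrArg (fun M => RCLike.re M.trace) hexpand
  simp only [trace_mul_conjTranspose_self, trace_add, trace_smul, map_add, RCLike.ofReal_re,
    map_nsmul] at htrace
  rw [hfactor]
  refine le_of_sq_le_sq ?_ (norm_nonneg _)
  rw [htrace, add_assoc]
  exact le_add_of_nonneg_right (by positivity)

theorem norm_trace_mul_mul_sub_le (A R : Matrix n n 𝕜) :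
    ‖(R * A * R - A).trace‖ ≤ (2 * ‖R - 1‖ + ‖R - 1‖ ^ 2) * ‖A‖ := by
  set T := R - 1 with hT
  have htrace : (R * A * R - A).trace = (A * (T * T + T + T)).trace := by
    have hsq : T * T + T + T = R * R - 1 := by rw [hT]; noncomm_ring
    rw [hsq, mul_sub, mul_one, trace_sub, trace_sub, mul_assoc, trace_mul_comm, mul_assoc]
  calc ‖(R * A * R - A).trace‖ ≤ ‖A‖ * ‖T * T + T + T‖ := htrace ▸ norm_trace_mul_le _ _
    _ ≤ ‖A‖ * (‖T‖ * ‖T‖ + ‖T‖ + ‖T‖) := by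
        gcongr
        exact norm_add₃_le.trans (by gcongr; exact norm_mul_le _ _)
    _ = (2 * ‖T‖ + ‖T‖ ^ 2) * ‖A‖ := by ring

end Frobenius

section NormedRing

variable {R : Type*} [NormedRing R]

theorem norm_sub_one_le_of_mul_eq_one {x y : R} (hxy : x * y = 1) (hx : ‖x - 1‖ ≤ 1 / 2) :
    ‖y - 1‖ ≤ 2 * ‖x - 1‖ := by
  have hy : y - 1 = -((x - 1) * (y - 1)) - (x - 1) := by
    have : (x - 1) * (y - 1) = x * y - x - y + 1 := by noncomm_ring
    rw [this, hxy]
    abel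
  have hle : ‖y - 1‖ ≤ ‖x - 1‖ * ‖y - 1‖ + ‖x - 1‖ :=
    calc ‖y - 1‖ ≤ ‖(x - 1) * (y - 1)‖ + ‖x - 1‖ := by
          conv_lhs => rw [hy]
          exact (norm_sub_le _ _).trans_eq (by rw [norm_neg])
      _ ≤ ‖x - 1‖ * ‖y - 1‖ + ‖x - 1‖ := by gcongr; exact norm_mul_le _ _
  nlinarith [norm_nonneg (y - 1)]

theorem norm_mul_mul_sub_le (x r : R) :
    ‖r * x * r - x‖ ≤ (2 * ‖r - 1‖ + ‖r - 1‖ ^ 2) * ‖x‖ := by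
  set t := r - 1 with ht
  calc ‖r * x * r - x‖ = ‖t * x * t + t * x + x * t‖ := by rw [ht]; noncomm_ring
    _ ≤ ‖t * x * t‖ + ‖t * x‖ + ‖x * t‖ := norm_add₃_le
    _ ≤ ‖t‖ * ‖x‖ * ‖t‖ + ‖t‖ * ‖x‖ + ‖x‖ * ‖t‖ := by
        gcongr
        · exact (norm_mul_le _ _).trans (by gcongr; exact norm_mul_le _ _)
        · exact norm_mul_le _ _
        · exact norm_mul_le _ _
    _ = (2 * ‖t‖ + ‖t‖ ^ 2) * ‖x‖ := by ring

end NormedRing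

section QuadForm

open Matrix
open scoped Matrix.Norms.Frobenius

variable {n : Type*} [Fintype n]

/-- The quadratic form `⟨z|Δ|z⟩` of a complex matrix. -/
def quadForm (Δ : Matrix n n ℂ) (z : EuclideanSpace ℂ n) : ℂ := star z.ofLp ⬝ᵥ Δ *ᵥ z.ofLp

theorem quadForm_add (A B : Matrix n n ℂ) (z : EuclideanSpace ℂ n) :
    quadForm (A + B) z = quadForm A z + quadForm B z := by
  rw [quadForm, add_mulVec, dotProduct_add, quadForm, quadForm]

theorem quadForm_smul (c : ℂ) (A : Matrix n n ℂ) (z : EuclideanSpace ℂ n) :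
    quadForm (c • A) z = c * quadForm A z := by
  rw [quadForm, smul_mulVec, dotProduct_smul, smul_eq_mul, quadForm]

theorem quadForm_real_smul (r : ℝ) (A : Matrix n n ℂ) (z : EuclideanSpace ℂ n) :
    quadForm (r • A) z = r * quadForm A z := by
  rw [← Complex.coe_smul, quadForm_smul]

theorem quadForm_smul_vec (A : Matrix n n ℂ) (r : ℝ) (z : EuclideanSpace ℂ n) :
    quadForm A (r • z) = (r ^ 2 : ℝ) * quadForm A z := by
  have hcoe : (r • z).ofLp = (r : ℂ) • z.ofLp := by
    ext i
    simp only [PiLp.smul_apply, Complex.real_smul, Pi.smul_apply, smul_eq_mul]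
  rw [quadForm, hcoe, mulVec_smul, star_smul, smul_dotProduct, dotProduct_smul, smul_smul,
    RCLike.star_def, Complex.conj_ofReal, ← sq, smul_eq_mul, quadForm, Complex.ofReal_pow]

theorem continuous_quadForm (A : Matrix n n ℂ) : Continuous (quadForm A) := by
  have : Continuous fun z : EuclideanSpace ℂ n => z.ofLp := PiLp.continuous_ofLp 2 _
  unfold quadForm
  fun_prop

theorem quadForm_eq_trace (A : Matrix n n ℂ) (z : EuclideanSpace ℂ n) :
    quadForm A z = (A * vecMulVec z.ofLp (star z.ofLp)).trace := by
  rw [mul_vecMulVec, trace_vecMulVec, dotProduct_comm, quadForm]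

theorem quadForm_eq_re_add_im (A : Matrix n n ℂ) (z : EuclideanSpace ℂ n) :
    quadForm A z = quadForm (realPart A : Matrix n n ℂ) z
      + Complex.I * quadForm (imaginaryPart A : Matrix n n ℂ) z := by
  rw [← quadForm_smul, ← quadForm_add, realPart_add_I_smul_imaginaryPart]

section Hermitian

variable {A : Matrix n n ℂ} (hA : A.IsHermitian)

include hA in
theorem ofReal_re_quadForm (z : EuclideanSpace ℂ n) : ((quadForm A z).re : ℂ) = quadForm A z :=
  Complex.ext rfl (by simpa [quadForm] using (hA.im_star_dotProduct_mulVec_self z.ofLp).symm)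

variable [DecidableEq n]

theorem quadForm_eq_sum_eigenvalues (z : EuclideanSpace ℂ n) :
    quadForm A z = (∑ j, hA.eigenvalues j * ‖hA.eigenvectorBasis.repr z j‖ ^ 2 : ℝ) := by
  set b := hA.eigenvectorBasis
  have heigen : ∀ j, toEuclideanLin A (b j) = (hA.eigenvalues j : ℂ) • b j := fun j => by
    ext i
    simpa using congrFun (hA.mulVec_eigenvectorBasis j) i
  have hcoord : ∀ j, inner ℂ (b j) (toEuclideanLin A z) = hA.eigenvalues j * inner ℂ (b j) z :=
    fun j => by
      rw [← isSymmetric_toEuclideanLin_iff.2 hA (b j) z, heigen, inner_smul_left,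
        Complex.conj_ofReal]
  calc quadForm A z = inner ℂ z (toEuclideanLin A z) := by
        rw [EuclideanSpace.inner_eq_star_dotProduct, dotProduct_comm]
        rfl
    _ = ∑ j, inner ℂ z (b j) * inner ℂ (b j) (toEuclideanLin A z) :=
        (b.sum_inner_mul_inner _ _).symm
    _ = (∑ j, hA.eigenvalues j * ‖b.repr z j‖ ^ 2 : ℝ) := by
        push_cast
        refine Finset.sum_congr rfl fun j _ => ?_
        rw [hcoord, OrthonormalBasis.repr_apply_apply, mul_left_comm, ← inner_conj_symm z (b j),
          Complex.conj_mul']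

theorem frobenius_norm_sq_eq_sum_eigenvalues_sq : ‖A‖ ^ 2 = ∑ j, hA.eigenvalues j ^ 2 := by
  have hdiag : (A * Aᴴ).trace = ((∑ j, hA.eigenvalues j ^ 2 : ℝ) : ℂ) := by
    rw [hA.eq]
    conv_lhs => rw [hA.spectral_theorem, ← map_mul]
    rw [Unitary.conjStarAlgAut_apply, mul_assoc, trace_mul_comm, mul_assoc,
      Unitary.coe_star_mul_self, mul_one, diagonal_mul_diagonal, trace_diagonal]
    simp only [Function.comp_apply, Complex.coe_algebraMap, ← sq, ← Complex.ofReal_pow,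
      Complex.ofReal_sum]
  rw [trace_mul_conjTranspose_self] at hdiag
  exact Complex.ofReal_injective hdiag

theorem re_trace_eq_sum_eigenvalues : A.trace.re = ∑ j, hA.eigenvalues j := by
  rw [hA.trace_eq_sum_eigenvalues, Complex.re_sum]
  rfl

end Hermitian

end QuadForm

theorem convexOn_cosh : ConvexOn ℝ Set.univ cosh := by
  refine convexOn_univ_of_deriv2_nonneg differentiable_cosh ?_ fun x => ?_
  · rw [Real.deriv_cosh]
    exact differentiable_sinh
  · rw [Function.iterate_succ_apply, Function.iterate_one, Real.deriv_cosh, Real.deriv_sinh]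
    exact (cosh_pos x).le

section ComplexGaussian

open Matrix
open scoped Matrix.Norms.Frobenius

variable {d : ℕ}

/-- The standard complex Gaussian distribution on `ℂ^d`, with density proportional to
`exp (-‖z‖²)`; its coordinates in an orthonormal basis are independent with `𝔼 |z_i|² = 1`. -/
def complexGaussian (d : ℕ) : Measure (EuclideanSpace ℂ (Fin d)) := volume.tilted fun z => -‖z‖ ^ 2

/-- The coordinates in an orthonormal basis, as a continuous real-linear equivalence. -/
def basisCoords (b : OrthonormalBasis (Fin d) ℂ (EuclideanSpace ℂ (Fin d))) :
    EuclideanSpace ℂ (Fin d) ≃L[ℝ] (Fin d → ℂ) :=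
  (ContinuousLinearEquiv.restrictScalars ℝ b.repr.toContinuousLinearEquiv).trans
    (PiLp.continuousLinearEquiv 2 ℝ fun _ : Fin d => ℂ)

theorem map_basisCoords_complexGaussian
    (b : OrthonormalBasis (Fin d) ℂ (EuclideanSpace ℂ (Fin d))) :
    (complexGaussian d).map (basisCoords b) = .pi fun _ => complexNormal := by
  refine map_tilted_neg_norm_sq volume (basisCoords b) fun z => ?_
  rw [← b.repr.norm_map z, EuclideanSpace.norm_sq_eq]
  rfl

instance : IsProbabilityMeasure (complexGaussian d) := by
  set b := EuclideanSpace.basisFun (Fin d) ℂ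
  have : IsProbabilityMeasure ((complexGaussian d).map (basisCoords b)) := by
    rw [map_basisCoords_complexGaussian]
    infer_instance
  exact Measure.isProbabilityMeasure_of_map (basisCoords b)

variable {A : Matrix (Fin d) (Fin d) ℂ} (hA : A.IsHermitian)
include hA

theorem map_re_quadForm_complexGaussian :
    (complexGaussian d).map (fun z => (quadForm A z).re) =
      (Measure.pi fun _ : Fin d => complexNormal).map
        fun x => ∑ j, hA.eigenvalues j * ‖x j‖ ^ 2 := by
  rw [← map_basisCoords_complexGaussian hA.eigenvectorBasis,
    Measure.map_map (by fun_prop) (basisCoords _).continuous.measurable]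
  congr 1
  ext z
  rw [quadForm_eq_sum_eigenvalues hA, Complex.ofReal_re]
  rfl

theorem integral_comp_re_quadForm_complexGaussian {f : ℝ → ℝ} (hf : Continuous f) :
    ∫ z, f (quadForm A z).re ∂(complexGaussian d) =
      ∫ x : Fin d → ℂ, f (∑ j, hA.eigenvalues j * ‖x j‖ ^ 2) ∂(.pi fun _ => complexNormal) := by
  have hq := (Complex.continuous_re.comp (continuous_quadForm A)).measurable
  rw [← integral_map (φ := fun z => (quadForm A z).re) hq.aemeasurable hf.aestronglyMeasurable,
    map_re_quadForm_complexGaussian hA,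
    integral_map (memLp_diagForm _).aemeasurable hf.aestronglyMeasurable]

theorem integral_re_quadForm_complexGaussian :
    ∫ z, (quadForm A z).re ∂(complexGaussian d) = A.trace.re := by
  rw [re_trace_eq_sum_eigenvalues hA, ← integral_diagForm]
  exact integral_comp_re_quadForm_complexGaussian hA continuous_id

theorem integral_re_quadForm_sq_complexGaussian :
    ∫ z, (quadForm A z).re ^ 2 ∂(complexGaussian d) = A.trace.re ^ 2 + ‖A‖ ^ 2 := by
  rw [integral_comp_re_quadForm_complexGaussian hA (continuous_pow 2), integral_diagForm_sq,
    re_trace_eq_sum_eigenvalues hA, frobenius_norm_sq_eq_sum_eigenvalues_sq hA]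

theorem integrable_and_integral_cosh_complexGaussian_le_two
    (h : A.trace.re ^ 2 + ‖A‖ ^ 2 ≤ 1) :
    Integrable (fun z => cosh ((quadForm A z).re / 2)) (complexGaussian d) ∧
      ∫ z, cosh ((quadForm A z).re / 2) ∂(complexGaussian d) ≤ 2 := by
  rw [re_trace_eq_sum_eigenvalues hA, frobenius_norm_sq_eq_sum_eigenvalues_sq hA] at h
  obtain ⟨hint, hle⟩ := integrable_and_integral_cosh_diagForm_le_two h
  have hf : Continuous fun y : ℝ => cosh (y / 2) := continuous_cosh.comp (continuous_id.div_const 2)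
  have hq := (Complex.continuous_re.comp (continuous_quadForm A)).measurable
  refine ⟨?_, (integral_comp_re_quadForm_complexGaussian hA hf).trans_le hle⟩
  refine (integrable_map_measure (f := fun z => (quadForm A z).re) hf.aestronglyMeasurable
    hq.aemeasurable).1 ?_
  rw [map_re_quadForm_complexGaussian hA]
  exact (integrable_map_measure hf.aestronglyMeasurable
    (memLp_diagForm _).aemeasurable).2 hint

end ComplexGaussian

section SphereMoments

open Matrix
open scoped Matrix.Norms.Frobenius

variable {d : ℕ}

theorem continuous_quadForm_sphere (A : Matrix (Fin d) (Fin d) ℂ) :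
    Continuous fun ψ : UnitSphere d => quadForm A ψ :=
  (continuous_quadForm A).comp continuous_subtype_val

theorem quadForm_one_sphere (ψ : UnitSphere d) : quadForm 1 (ψ : EuclideanSpace ℂ (Fin d)) = 1 := by
  rw [quadForm, one_mulVec, dotProduct_comm, ← EuclideanSpace.inner_eq_star_dotProduct,
    inner_self_eq_norm_sq_to_K, norm_eq_of_mem_sphere]
  norm_num

variable [NeZero d]

instance : IsProbabilityMeasure (uniformSphere d) := by
  refine ⟨?_⟩
  rw [uniformSphere, Measure.smul_apply, smul_eq_mul]
  exact ENNReal.inv_mul_cancel (Measure.measure_univ_ne_zero.2 (Measure.toSphere_ne_zero _))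
    (measure_ne_top _ _)

theorem exists_radial_law :
    ∃ ρ : Measure (Set.Ioi (0 : ℝ)), IsProbabilityMeasure ρ ∧
      ((uniformSphere d).prod ρ).map (fun p => (p.2 : ℝ) • (p.1 : EuclideanSpace ℂ (Fin d)))
        = complexGaussian d := by
  set Z := ∫ z : EuclideanSpace ℂ (Fin d), exp (-‖z‖ ^ 2)
  have htilted : complexGaussian d =
      volume.withDensity fun z => ENNReal.ofReal (exp (-‖z‖ ^ 2) / Z) := rfl
  have : IsProbabilityMeasure ((volume : Measure (EuclideanSpace ℂ (Fin d))).withDensity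
      fun z => ENNReal.ofReal (exp (-‖z‖ ^ 2) / Z)) := by
    rw [← htilted]
    infer_instance
  exact exists_map_smul_eq_withDensity_norm volume
    (w := fun r => ENNReal.ofReal (exp (-r ^ 2) / Z)) (by fun_prop)

theorem integrable_of_continuous_sphere {F : Type*} [NormedAddCommGroup F]
    {f : UnitSphere d → F} (hf : Continuous f) : Integrable f (uniformSphere d) :=
  hf.integrable_of_hasCompactSupport (.of_compactSpace f)

section Radial

variable {ρ : Measure (Set.Ioi (0 : ℝ))} [IsProbabilityMeasure ρ]
  (hρ : ((uniformSphere d).prod ρ).map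
    (fun p => (p.2 : ℝ) • (p.1 : EuclideanSpace ℂ (Fin d))) = complexGaussian d)
include hρ

theorem integral_re_quadForm_pow_complexGaussian (A : Matrix (Fin d) (Fin d) ℂ) (k : ℕ) :
    ∫ z, (quadForm A z).re ^ k ∂(complexGaussian d) =
      (∫ r, ((r : ℝ) ^ 2) ^ k ∂ρ) * ∫ ψ, (quadForm A ψ).re ^ k ∂(uniformSphere d) := by
  have hc : Continuous fun z => (quadForm A z).re ^ k :=
    (Complex.continuous_re.comp (continuous_quadForm A)).pow k
  rw [← hρ, integral_map (by fun_prop) hc.aestronglyMeasurable, mul_comm,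
    ← integral_prod_mul (fun ψ : UnitSphere d => (quadForm A ψ).re ^ k)]
  simp only [quadForm_smul_vec, Complex.re_ofReal_mul, mul_pow,
    mul_comm]

theorem integral_radial_sq_pow (k : ℕ) :
    ∫ r, ((r : ℝ) ^ 2) ^ k ∂ρ =
      ∫ z, (quadForm (1 : Matrix (Fin d) (Fin d) ℂ) z).re ^ k ∂(complexGaussian d) := by
  simp [integral_re_quadForm_pow_complexGaussian hρ, quadForm_one_sphere]

theorem integral_radial_sq : ∫ r, (r : ℝ) ^ 2 ∂ρ = d := by
  have h := integral_radial_sq_pow hρ 1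
  simpa only [pow_one, integral_re_quadForm_complexGaussian isHermitian_one, trace_one,
    Fintype.card_fin, Complex.natCast_re] using h

theorem integral_radial_fourth : ∫ r, ((r : ℝ) ^ 2) ^ 2 ∂ρ = d * (d + 1) := by
  have hone : ‖(1 : Matrix (Fin d) (Fin d) ℂ)‖ ^ 2 = d := by
    have h := trace_mul_conjTranspose_self (1 : Matrix (Fin d) (Fin d) ℂ)
    rw [conjTranspose_one, mul_one, trace_one, Fintype.card_fin, ← Complex.ofReal_natCast] at h
    exact (Complex.ofReal_injective h).symm
  rw [integral_radial_sq_pow hρ, integral_re_quadForm_sq_complexGaussian isHermitian_one, hone,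
    trace_one, Fintype.card_fin, Complex.natCast_re]
  ring

/-- Jensen's inequality in the radial variable replaces `r²` by its mean `d`. -/
theorem integral_cosh_sphere_le_complexGaussian {A : Matrix (Fin d) (Fin d) ℂ}
    (hint : Integrable (fun z => cosh ((quadForm A z).re / 2)) (complexGaussian d)) :
    ∫ ψ, cosh (d * (quadForm A ψ).re / 2) ∂(uniformSphere d) ≤
      ∫ z, cosh ((quadForm A z).re / 2) ∂(complexGaussian d) := by
  have hsq : Integrable (fun r : Set.Ioi (0 : ℝ) => (r : ℝ) ^ 2) ρ :=
    .of_integral_ne_zero (by rw [integral_radial_sq hρ]; exact NeZero.ne _)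
  have hm : AEMeasurable (fun p : UnitSphere d × Set.Ioi (0 : ℝ) =>
      (p.2 : ℝ) • (p.1 : EuclideanSpace ℂ (Fin d))) ((uniformSphere d).prod ρ) := by fun_prop
  have hprod := hint
  have hmeas := hint.aestronglyMeasurable
  rw [← hρ] at hprod hmeas
  rw [integrable_map_measure hmeas hm] at hprod
  simp only [Function.comp_def, quadForm_smul_vec, Complex.re_ofReal_mul] at hprod
  have hjensen : ∀ᵐ ψ : UnitSphere d ∂(uniformSphere d), cosh (d * (quadForm A ψ).re / 2) ≤
      ∫ r, cosh ((r : ℝ) ^ 2 * (quadForm A ψ).re / 2) ∂ρ := by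
    filter_upwards [hprod.prod_right_ae] with ψ hψ
    refine le_of_eq_of_le ?_ (convexOn_cosh.map_integral_le continuous_cosh.continuousOn
      isClosed_univ (.of_forall fun _ => Set.mem_univ _)
      ((hsq.mul_const (quadForm A ψ).re).div_const 2) hψ)
    rw [integral_div, integral_mul_const, integral_radial_sq hρ]
  have hc : Continuous fun ψ : UnitSphere d => cosh (d * (quadForm A ψ).re / 2) := by
    have := continuous_cosh
    have := continuous_quadForm_sphere A
    fun_prop
  calc ∫ ψ, cosh (d * (quadForm A ψ).re / 2) ∂(uniformSphere d)
      ≤ ∫ ψ, ∫ r, cosh ((r : ℝ) ^ 2 * (quadForm A ψ).re / 2) ∂ρ ∂(uniformSphere d) :=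
        integral_mono_ae (integrable_of_continuous_sphere hc) hprod.integral_prod_left hjensen
    _ = ∫ z, cosh ((quadForm A z).re / 2) ∂(complexGaussian d) := by
        rw [← integral_prod _ hprod, ← hρ, integral_map hm hmeas]
        simp only [quadForm_smul_vec, Complex.re_ofReal_mul]

end Radial

variable {A : Matrix (Fin d) (Fin d) ℂ} (hA : A.IsHermitian)
include hA

theorem integral_re_quadForm_sphere_of_isHermitian :
    d * ∫ ψ, (quadForm A ψ).re ∂(uniformSphere d) = A.trace.re := by
  obtain ⟨ρ, _, hρ⟩ := exists_radial_law (d := d)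
  have h := integral_re_quadForm_pow_complexGaussian hρ A 1
  simpa only [pow_one, integral_radial_sq hρ, integral_re_quadForm_complexGaussian hA]
    using h.symm

theorem integral_re_quadForm_sq_sphere :
    d * (d + 1) * ∫ ψ, (quadForm A ψ).re ^ 2 ∂(uniformSphere d) = A.trace.re ^ 2 + ‖A‖ ^ 2 := by
  obtain ⟨ρ, _, hρ⟩ := exists_radial_law (d := d)
  rw [← integral_re_quadForm_sq_complexGaussian hA, integral_re_quadForm_pow_complexGaussian hρ,
    integral_radial_fourth hρ]

theorem integral_cosh_re_quadForm_sphere_le_two (h : A.trace.re ^ 2 + ‖A‖ ^ 2 ≤ 1) :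
    ∫ ψ, cosh (d * (quadForm A ψ).re / 2) ∂(uniformSphere d) ≤ 2 := by
  obtain ⟨ρ, _, hρ⟩ := exists_radial_law (d := d)
  obtain ⟨hint, hle⟩ := integrable_and_integral_cosh_complexGaussian_le_two hA h
  exact (integral_cosh_sphere_le_complexGaussian hρ hint).trans hle

end SphereMoments

section UniformNorm

open Matrix
open scoped Matrix.Norms.Frobenius

theorem isHermitian_realPart {n : Type*} (A : Matrix n n ℂ) :
    (realPart A : Matrix n n ℂ).IsHermitian :=
  (realPart A).2

theorem isHermitian_imaginaryPart {n : Type*} (A : Matrix n n ℂ) :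
    (imaginaryPart A : Matrix n n ℂ).IsHermitian :=
  (imaginaryPart A).2

section Parts

variable {n : Type*} [Fintype n] (A : Matrix n n ℂ)

theorem trace_realPart :
    (realPart A : Matrix n n ℂ).trace = A.trace.re := by
  rw [realPart_apply_coe, trace_smul, trace_add, star_eq_conjTranspose, trace_conjTranspose,
    RCLike.star_def, Complex.add_conj, Complex.real_smul]
  push_cast
  ring

theorem trace_imaginaryPart :
    (imaginaryPart A : Matrix n n ℂ).trace = A.trace.im := by
  rw [imaginaryPart_apply_coe, trace_smul, trace_smul, trace_sub, star_eq_conjTranspose,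
    trace_conjTranspose, RCLike.star_def, Complex.sub_conj, Complex.real_smul, smul_eq_mul]
  push_cast
  linear_combination (-A.trace.im : ℂ) * Complex.I_sq

theorem re_quadForm (z : EuclideanSpace ℂ n) :
    (quadForm A z).re = (quadForm (realPart A : Matrix n n ℂ) z).re := by
  rw [quadForm_eq_re_add_im, ← ofReal_re_quadForm (isHermitian_realPart A),
    ← ofReal_re_quadForm (isHermitian_imaginaryPart A)]
  simp

theorem im_quadForm (z : EuclideanSpace ℂ n) :
    (quadForm A z).im = (quadForm (imaginaryPart A : Matrix n n ℂ) z).re := by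
  rw [quadForm_eq_re_add_im, ← ofReal_re_quadForm (isHermitian_realPart A),
    ← ofReal_re_quadForm (isHermitian_imaginaryPart A)]
  simp

theorem norm_realPart_le : ‖(realPart A : Matrix n n ℂ)‖ ≤ ‖A‖ := realPart.norm_le A

theorem norm_imaginaryPart_le : ‖(imaginaryPart A : Matrix n n ℂ)‖ ≤ ‖A‖ := imaginaryPart.norm_le A

end Parts

variable {d : ℕ} [NeZero d]

theorem integral_re_quadForm_sphere (A : Matrix (Fin d) (Fin d) ℂ) :
    d * ∫ ψ, (quadForm A ψ).re ∂(uniformSphere d) = A.trace.re := by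
  simp only [re_quadForm A]
  rw [integral_re_quadForm_sphere_of_isHermitian (isHermitian_realPart A), trace_realPart,
    Complex.ofReal_re]

theorem integral_im_quadForm_sphere (A : Matrix (Fin d) (Fin d) ℂ) :
    d * ∫ ψ, (quadForm A ψ).im ∂(uniformSphere d) = A.trace.im := by
  simp only [im_quadForm A]
  rw [integral_re_quadForm_sphere_of_isHermitian (isHermitian_imaginaryPart A),
    trace_imaginaryPart, Complex.ofReal_re]

theorem integral_quadForm_sphere (A : Matrix (Fin d) (Fin d) ℂ) :
    d * ∫ ψ, quadForm A ψ ∂(uniformSphere d) = A.trace := by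
  have hint := integrable_of_continuous_sphere (continuous_quadForm_sphere A)
  rw [← Complex.ofReal_natCast]
  refine Complex.ext ?_ ?_
  · rw [Complex.re_ofReal_mul, ← integral_re_quadForm_sphere]
    exact congrArg _ (integral_re hint).symm
  · rw [Complex.im_ofReal_mul, ← integral_im_quadForm_sphere]
    exact congrArg _ (integral_im hint).symm

theorem integrable_norm_quadForm_sphere (A : Matrix (Fin d) (Fin d) ℂ) :
    Integrable (fun ψ : UnitSphere d => ‖quadForm A ψ‖) (uniformSphere d) :=
  integrable_of_continuous_sphere (continuous_quadForm_sphere A).norm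

/-- The distinguishability norm of the uniform POVM, extended to all matrices and bundled as a
seminorm. -/
def uniformSeminorm (d : ℕ) [NeZero d] : Seminorm ℂ (Matrix (Fin d) (Fin d) ℂ) :=
  .of (uniformNorm d)
    (fun A B => by
      have hint := integrable_norm_quadForm_sphere (d := d)
      calc d * ∫ ψ, ‖quadForm (A + B) ψ‖ ∂(uniformSphere d)
          ≤ d * ∫ ψ, (‖quadForm A ψ‖ + ‖quadForm B ψ‖) ∂(uniformSphere d) := by
            refine mul_le_mul_of_nonneg_left
              (integral_mono (hint _) ((hint A).add (hint B)) fun ψ => ?_) d.cast_nonneg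
            rw [quadForm_add]
            exact norm_add_le _ _
        _ = uniformNorm d A + uniformNorm d B := by
            rw [integral_add (hint A) (hint B), mul_add]
            rfl)
    (fun c A => by
      change d * ∫ ψ, ‖quadForm (c • A) ψ‖ ∂(uniformSphere d) =
        ‖c‖ * (d * ∫ ψ, ‖quadForm A ψ‖ ∂(uniformSphere d))
      simp only [quadForm_smul, norm_mul, integral_const_mul]
      ring)

theorem uniformSeminorm_apply (A : Matrix (Fin d) (Fin d) ℂ) :
    uniformSeminorm d A = uniformNorm d A := rfl

theorem uniformSeminorm_eq (A : Matrix (Fin d) (Fin d) ℂ) :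
    uniformSeminorm d A = d * ∫ ψ, ‖quadForm A ψ‖ ∂(uniformSphere d) := rfl

theorem norm_trace_le_uniformSeminorm (A : Matrix (Fin d) (Fin d) ℂ) :
    ‖A.trace‖ ≤ uniformSeminorm d A := by
  rw [← integral_quadForm_sphere, norm_mul, uniformSeminorm_eq, Complex.norm_natCast]
  gcongr
  exact norm_integral_le_integral_norm _

theorem uniformSeminorm_mono {A B : Matrix (Fin d) (Fin d) ℂ}
    (h : ∀ ψ : UnitSphere d, ‖quadForm A ψ‖ ≤ ‖quadForm B ψ‖) :
    uniformSeminorm d A ≤ uniformSeminorm d B :=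
  mul_le_mul_of_nonneg_left (integral_mono (integrable_norm_quadForm_sphere A)
    (integrable_norm_quadForm_sphere B) h) d.cast_nonneg

theorem uniformSeminorm_realPart_le (A : Matrix (Fin d) (Fin d) ℂ) :
    uniformSeminorm d (realPart A : Matrix (Fin d) (Fin d) ℂ) ≤ uniformSeminorm d A := by
  refine uniformSeminorm_mono fun ψ => ?_
  rw [← ofReal_re_quadForm (isHermitian_realPart A), ← re_quadForm, Complex.norm_real]
  exact Complex.abs_re_le_norm _

theorem uniformSeminorm_imaginaryPart_le (A : Matrix (Fin d) (Fin d) ℂ) :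
    uniformSeminorm d (imaginaryPart A : Matrix (Fin d) (Fin d) ℂ) ≤ uniformSeminorm d A := by
  refine uniformSeminorm_mono fun ψ => ?_
  rw [← ofReal_re_quadForm (isHermitian_imaginaryPart A), ← im_quadForm, Complex.norm_real]
  exact Complex.abs_im_le_norm _

end UniformNorm

theorem pow_four_le_cosh (x : ℝ) : x ^ 4 ≤ 48 * cosh x := by
  have hexp := pow_div_factorial_le_exp |x| (abs_nonneg x) 4
  rw [Even.pow_abs (by decide)] at hexp
  rw [← cosh_abs, cosh_eq]
  norm_num [Nat.factorial] at hexp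
  linarith [exp_pos (-|x|)]

/-- A Paley–Zygmund type estimate: the exponential moment bounds the fourth moment, which together
with the second moment bounds the first moment from below. -/
theorem one_le_mul_integral_abs {Ω : Type*} [MeasurableSpace Ω] {μ : Measure Ω} {Y : Ω → ℝ}
    (hint : Integrable (fun ω => |Y ω|) μ) (hcosh : Integrable (fun ω => cosh (Y ω / 2)) μ)
    (hcosh_le : ∫ ω, cosh (Y ω / 2) ∂μ ≤ 2) (hsq : 1 ≤ 2 * ∫ ω, Y ω ^ 2 ∂μ) :
    1 ≤ 256 * ∫ ω, |Y ω| ∂μ := by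
  have hle : ∀ y : ℝ, y ^ 2 ≤ 64 * |y| + 3 / 64 * cosh (y / 2) := fun y => by
    have h4 := pow_four_le_cosh (y / 2)
    rw [div_pow, ← Even.pow_abs (by decide : Even 4)] at h4
    have hcubic : 0 ≤ |y| * ((|y| - 80) ^ 2 * (|y| + 160)) := by positivity
    rw [← sq_abs]
    nlinarith [abs_nonneg y]
  have hmono : ∫ ω, Y ω ^ 2 ∂μ ≤ ∫ ω, (64 * |Y ω| + 3 / 64 * cosh (Y ω / 2)) ∂μ :=
    integral_mono_of_nonneg (.of_forall fun ω => sq_nonneg _)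
      ((hint.const_mul 64).add (hcosh.const_mul (3 / 64))) (.of_forall fun ω => hle _)
  rw [integral_add (hint.const_mul 64) (hcosh.const_mul (3 / 64)), integral_const_mul,
    integral_const_mul] at hmono
  linarith

section Comparison

open Matrix
open scoped Matrix.Norms.Frobenius

variable {d : ℕ} [NeZero d] {A : Matrix (Fin d) (Fin d) ℂ}

theorem integrable_cosh_quadForm_sphere (A : Matrix (Fin d) (Fin d) ℂ) (c : ℝ) :
    Integrable (fun ψ : UnitSphere d => cosh (d * (quadForm A ψ).re / c)) (uniformSphere d) := by
  have := continuous_cosh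
  have := continuous_quadForm_sphere A
  exact integrable_of_continuous_sphere (by fun_prop)

theorem uniformSeminorm_eq_of_isHermitian (hA : A.IsHermitian) :
    uniformSeminorm d A = ∫ ψ, |d * (quadForm A ψ).re| ∂(uniformSphere d) := by
  simp_rw [uniformSeminorm_eq, abs_mul, Nat.abs_cast, integral_const_mul, ← norm_eq_abs,
    ← Complex.norm_real, ofReal_re_quadForm hA]

theorem one_le_uniformSeminorm_of_isHermitian (hA : A.IsHermitian)
    (h : A.trace.re ^ 2 + ‖A‖ ^ 2 = 1) : 1 ≤ 256 * uniformSeminorm d A := by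
  have hd : (1 : ℝ) ≤ d := by exact_mod_cast NeZero.one_le
  have hsq := integral_re_quadForm_sq_sphere hA
  rw [h] at hsq
  rw [uniformSeminorm_eq_of_isHermitian hA]
  refine one_le_mul_integral_abs ?_ (integrable_cosh_quadForm_sphere A 2)
    (integral_cosh_re_quadForm_sphere_le_two hA h.le) ?_
  · have := continuous_quadForm_sphere A
    exact integrable_of_continuous_sphere (by fun_prop)
  · simp only [mul_pow, integral_const_mul]
    set I := ∫ ψ, (quadForm A ψ).re ^ 2 ∂(uniformSphere d)
    nlinarith [show 0 ≤ I from integral_nonneg fun ψ => sq_nonneg _]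

theorem frobenius_norm_le_uniformSeminorm_of_isHermitian (hA : A.IsHermitian) :
    ‖A‖ ≤ 256 * uniformSeminorm d A := by
  set s := √(A.trace.re ^ 2 + ‖A‖ ^ 2)
  have hle : ‖A‖ ≤ s := le_sqrt_of_sq_le (by nlinarith [sq_nonneg A.trace.re])
  have hs_nonneg : 0 ≤ s := sqrt_nonneg _
  rcases hs_nonneg.eq_or_lt with hs0 | hs0
  · rw [← hs0] at hle
    exact hle.trans (by positivity)
  · have hsq : s ^ 2 = A.trace.re ^ 2 + ‖A‖ ^ 2 := sq_sqrt (by positivity)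
    have hnorm := one_le_uniformSeminorm_of_isHermitian (A := ((s⁻¹ : ℝ) : ℂ) • A)
      (hA.smul (Complex.conj_ofReal _)) <| by
        rw [trace_smul, smul_eq_mul, Complex.re_ofReal_mul, norm_smul, Complex.norm_real,
          norm_eq_abs, mul_pow, mul_pow, sq_abs, ← mul_add, ← hsq, ← mul_pow,
          inv_mul_cancel₀ hs0.ne', one_pow]
    rw [map_smul_eq_mul, Complex.norm_real, norm_eq_abs, abs_of_pos (inv_pos.2 hs0)] at hnorm
    field_simp at hnorm
    linarith

theorem uniformSeminorm_le_of_isHermitian (hA : A.IsHermitian) :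
    uniformSeminorm d A ≤ |A.trace.re| + ‖A‖ := by
  have hd : (0 : ℝ) ≤ d := d.cast_nonneg
  have hcont := continuous_quadForm_sphere A
  have hsq := integral_re_quadForm_sq_sphere hA
  have hjensen : (∫ ψ, |d * (quadForm A ψ).re| ∂(uniformSphere d)) ^ 2 ≤
      ∫ ψ, |d * (quadForm A ψ).re| ^ 2 ∂(uniformSphere d) :=
    even_two.convexOn_pow.map_integral_le (continuous_pow 2).continuousOn isClosed_univ
      (.of_forall fun _ => Set.mem_univ _) (integrable_of_continuous_sphere (by fun_prop))
      (integrable_of_continuous_sphere (by simp only [Function.comp_def]; fun_prop))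
  rw [← uniformSeminorm_eq_of_isHermitian hA] at hjensen
  simp only [sq_abs, mul_pow, integral_const_mul] at hjensen
  refine abs_le_of_sq_le_sq' ?_ (by positivity) |>.2
  set I := ∫ ψ, (quadForm A ψ).re ^ 2 ∂(uniformSphere d)
  have hI : 0 ≤ I := integral_nonneg fun ψ => sq_nonneg _
  nlinarith [sq_abs A.trace.re, abs_nonneg A.trace.re, norm_nonneg A, mul_nonneg hd hI,
    mul_nonneg (abs_nonneg A.trace.re) (norm_nonneg A)]

theorem frobenius_norm_le_uniformSeminorm (A : Matrix (Fin d) (Fin d) ℂ) :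
    ‖A‖ ≤ 512 * uniformSeminorm d A := by
  set B : Matrix (Fin d) (Fin d) ℂ := (realPart A).1 with hB
  set C : Matrix (Fin d) (Fin d) ℂ := (imaginaryPart A).1 with hC
  calc ‖A‖ = ‖B + Complex.I • C‖ := by rw [hB, hC, realPart_add_I_smul_imaginaryPart]
    _ ≤ ‖B‖ + ‖C‖ := (norm_add_le _ _).trans_eq (by rw [norm_smul, Complex.norm_I, one_mul])
    _ ≤ 256 * uniformSeminorm d B + 256 * uniformSeminorm d C :=
        add_le_add (frobenius_norm_le_uniformSeminorm_of_isHermitian (isHermitian_realPart A))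
          (frobenius_norm_le_uniformSeminorm_of_isHermitian (isHermitian_imaginaryPart A))
    _ ≤ 512 * uniformSeminorm d A := by
        linarith [uniformSeminorm_realPart_le A, uniformSeminorm_imaginaryPart_le A]

theorem uniformSeminorm_le (A : Matrix (Fin d) (Fin d) ℂ) :
    uniformSeminorm d A ≤ 2 * (‖A.trace‖ + ‖A‖) := by
  have hre := uniformSeminorm_le_of_isHermitian (isHermitian_realPart A)
  have him := uniformSeminorm_le_of_isHermitian (isHermitian_imaginaryPart A)
  rw [trace_realPart, Complex.ofReal_re] at hre
  rw [trace_imaginaryPart, Complex.ofReal_re] at him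
  calc uniformSeminorm d A = uniformSeminorm d ((realPart A : Matrix (Fin d) (Fin d) ℂ)
        + Complex.I • (imaginaryPart A : Matrix (Fin d) (Fin d) ℂ)) := by
        rw [realPart_add_I_smul_imaginaryPart]
    _ ≤ uniformSeminorm d (realPart A : Matrix (Fin d) (Fin d) ℂ)
        + uniformSeminorm d (imaginaryPart A : Matrix (Fin d) (Fin d) ℂ) :=
        (map_add_le_add _ _ _).trans_eq (by rw [map_smul_eq_mul, Complex.norm_I, one_mul])
    _ ≤ 2 * (‖A.trace‖ + ‖A‖) := by
        linarith [Complex.abs_re_le_norm A.trace, Complex.abs_im_le_norm A.trace,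
          norm_realPart_le A, norm_imaginaryPart_le A]

theorem cosh_norm_le (z : ℂ) : cosh ‖z‖ ≤ (cosh (2 * z.re) + cosh (2 * z.im)) / 2 := by
  have hconv := convexOn_cosh.2 (Set.mem_univ (2 * |z.re|)) (Set.mem_univ (2 * |z.im|))
    (by norm_num : (0 : ℝ) ≤ 1 / 2) (by norm_num : (0 : ℝ) ≤ 1 / 2) (by norm_num)
  calc cosh ‖z‖ ≤ cosh (|z.re| + |z.im|) := by
        rw [cosh_le_cosh, abs_norm, abs_of_nonneg (by positivity)]
        exact Complex.norm_le_abs_re_add_abs_im z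
    _ ≤ (cosh |2 * z.re| + cosh |2 * z.im|) / 2 := by
        simp only [smul_eq_mul] at hconv
        rw [abs_mul, abs_mul, abs_two]
        ring_nf at hconv ⊢
        linarith
    _ = (cosh (2 * z.re) + cosh (2 * z.im)) / 2 := by rw [cosh_abs, cosh_abs]

theorem integral_cosh_norm_quadForm_sphere_le_two (h : ‖A.trace‖ + ‖A‖ ≤ 1) :
    ∫ ψ, cosh (d * ‖quadForm A ψ‖ / 4) ∂(uniformSphere d) ≤ 2 := by
  have hbound : ∀ B : Matrix (Fin d) (Fin d) ℂ, B.IsHermitian → |B.trace.re| ≤ ‖A.trace‖ →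
      ‖B‖ ≤ ‖A‖ → ∫ ψ, cosh (d * (quadForm B ψ).re / 2) ∂(uniformSphere d) ≤ 2 := by
    intro B hB htr hnorm
    refine integral_cosh_re_quadForm_sphere_le_two hB ?_
    rw [← sq_abs B.trace.re]
    nlinarith [abs_nonneg B.trace.re, norm_nonneg B]
  have hre := hbound _ (isHermitian_realPart A)
    (by simpa only [trace_realPart, Complex.ofReal_re] using Complex.abs_re_le_norm _)
    (norm_realPart_le A)
  have him := hbound _ (isHermitian_imaginaryPart A)
    (by simpa only [trace_imaginaryPart, Complex.ofReal_re] using Complex.abs_im_le_norm _)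
    (norm_imaginaryPart_le A)
  have hint_re := integrable_cosh_quadForm_sphere (realPart A : Matrix (Fin d) (Fin d) ℂ) 2
  have hint_im := integrable_cosh_quadForm_sphere (imaginaryPart A : Matrix (Fin d) (Fin d) ℂ) 2
  refine (integral_mono_of_nonneg (.of_forall fun ψ => (cosh_pos _).le)
    ((hint_re.add hint_im).div_const 2) (.of_forall fun ψ => ?_)).trans ?_
  · have hz := cosh_norm_le ((d / 4 : ℝ) * quadForm A ψ)
    rw [norm_mul, Complex.norm_real, norm_eq_abs, abs_of_nonneg (by positivity)] at hz
    simp only [Complex.re_ofReal_mul, Complex.im_ofReal_mul, re_quadForm A, im_quadForm A] at hz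
    simp only [Pi.add_apply]
    ring_nf at hz ⊢
    exact hz
  · rw [integral_div]
    simp only [Pi.add_apply]
    rw [integral_add hint_re hint_im]
    linarith

theorem integral_cosh_norm_quadForm_sphere_le_two_of_uniformSeminorm_le_one
    (h : uniformSeminorm d A ≤ 1) :
    ∫ ψ, cosh (d * ‖quadForm A ψ‖ / 1026 / 2) ∂(uniformSphere d) ≤ 2 := by
  have hle : ‖(((513 : ℝ)⁻¹ : ℝ) • A).trace‖ + ‖((513 : ℝ)⁻¹ : ℝ) • A‖ ≤ 1 := by
    rw [trace_smul, norm_smul, norm_smul, norm_inv, Real.norm_ofNat]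
    linarith [norm_trace_le_uniformSeminorm A, frobenius_norm_le_uniformSeminorm A]
  refine le_of_eq_of_le ?_ (integral_cosh_norm_quadForm_sphere_le_two hle)
  congr with ψ
  rw [quadForm_real_smul, norm_mul, Complex.norm_real, norm_inv, Real.norm_ofNat]
  ring_nf

theorem integral_cosh_re_quadForm_sphere_le_two_of_uniformSeminorm_le_one
    (h : uniformSeminorm d A ≤ 1) :
    ∫ ψ, cosh (d * (quadForm A ψ).re / 1026 / 2) ∂(uniformSphere d) ≤ 2 := by
  have := continuous_cosh
  have := continuous_quadForm_sphere A
  refine (integral_mono (integrable_of_continuous_sphere (by fun_prop))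
    (integrable_of_continuous_sphere (by fun_prop)) fun ψ => ?_).trans
    (integral_cosh_norm_quadForm_sphere_le_two_of_uniformSeminorm_le_one h)
  simp only [cosh_le_cosh, abs_div, abs_mul, Nat.abs_cast, abs_norm]
  gcongr
  exact Complex.abs_re_le_norm _

end Comparison

section Concentration

theorem exp_sub_one_sub_le (x : ℝ) : exp x - 1 - x ≤ x ^ 2 * exp |x| := by
  rcases le_or_gt |x| 1 with h | h
  · have hsq := (abs_le.1 (abs_exp_sub_one_sub_id_le h)).2
    nlinarith [one_le_exp (abs_nonneg x), sq_nonneg x]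
  · rcases le_total 0 x with hx | hx
    · rw [abs_of_nonneg hx] at h ⊢
      nlinarith [exp_pos x, mul_pos (sub_pos.2 h) (exp_pos x),
        mul_nonneg hx (mul_pos (sub_pos.2 h) (exp_pos x)).le]
    · have hexp := exp_le_one_iff.2 hx
      have hone := one_le_exp (abs_nonneg x)
      rw [abs_of_nonpos hx] at h hone ⊢
      nlinarith [sq_nonneg x]

theorem exp_le_two_mul_cosh {x y : ℝ} (h : |x| ≤ |y|) : exp x ≤ 2 * cosh y :=
  calc exp x ≤ exp |y| := exp_le_exp.2 ((le_abs_self x).trans h)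
    _ ≤ 2 * cosh y := by
      rw [cosh_eq]
      linarith [exp_abs_le y]

theorem exp_mul_le {θ x : ℝ} (hθ : |θ| ≤ 1 / 4) :
    exp (θ * x) ≤ 1 + θ * x + 64 * θ ^ 2 * cosh (x / 2) := by
  have hsq : x ^ 2 ≤ 32 * exp (|x| / 4) := by
    have hquad := quadratic_le_exp_of_nonneg (x := |x| / 4) (by positivity)
    rw [div_pow, sq_abs] at hquad
    linarith [abs_nonneg x]
  have hθx : |θ * x| ≤ |x| / 4 := by
    rw [abs_mul]
    nlinarith [abs_nonneg x]
  have hmain : (θ * x) ^ 2 * exp |θ * x| ≤ 64 * θ ^ 2 * cosh (x / 2) :=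
    calc (θ * x) ^ 2 * exp |θ * x| ≤ θ ^ 2 * (32 * exp (|x| / 4)) * exp (|x| / 4) := by
          rw [mul_pow]
          gcongr
      _ = 32 * θ ^ 2 * exp (|x| / 2) := by
          rw [show |x| / 2 = |x| / 4 + |x| / 4 by ring, exp_add]
          ring
      _ ≤ 32 * θ ^ 2 * (2 * cosh (x / 2)) := by
          gcongr
          exact exp_le_two_mul_cosh (by rw [abs_div, abs_div, abs_abs])
      _ = 64 * θ ^ 2 * cosh (x / 2) := by ring
  linarith [exp_sub_one_sub_le (θ * x)]

variable {Ω : Type*} [MeasurableSpace Ω] {P : Measure Ω}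

theorem integrable_exp_mul_of_integrable_cosh {X : Ω → ℝ} (hX : AEMeasurable X P)
    (hcosh : Integrable (fun ω => cosh (X ω / 2)) P) {θ : ℝ} (hθ : |θ| ≤ 1 / 4) :
    Integrable (fun ω => exp (θ * X ω)) P := by
  refine (hcosh.const_mul 2).mono' (by fun_prop) (.of_forall fun ω => ?_)
  rw [norm_of_nonneg (exp_pos _).le]
  refine exp_le_two_mul_cosh ?_
  rw [abs_mul, abs_div, abs_two]
  nlinarith [abs_nonneg (X ω)]

variable [IsProbabilityMeasure P]

theorem mgf_le_of_integral_cosh_le_two {X : Ω → ℝ} (hX : Integrable X P)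
    (hcosh : Integrable (fun ω => cosh (X ω / 2)) P) (hle : ∫ ω, cosh (X ω / 2) ∂P ≤ 2)
    {θ : ℝ} (hθ : |θ| ≤ 1 / 4) :
    mgf X P θ ≤ exp (θ * P[X] + 128 * θ ^ 2) := by
  have hlin : Integrable (fun ω => 1 + θ * X ω) P := (integrable_const 1).add (hX.const_mul θ)
  calc mgf X P θ ≤ ∫ ω, (1 + θ * X ω + 64 * θ ^ 2 * cosh (X ω / 2)) ∂P :=
        integral_mono_of_nonneg (.of_forall fun ω => (exp_pos _).le)
          (hlin.add (hcosh.const_mul _)) (.of_forall fun ω => exp_mul_le hθ)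
    _ = 1 + θ * P[X] + 64 * θ ^ 2 * ∫ ω, cosh (X ω / 2) ∂P := by
        rw [integral_add hlin (hcosh.const_mul _), integral_add (integrable_const 1)
          (hX.const_mul θ), integral_const_mul, integral_const_mul, integral_const, probReal_univ,
          one_smul]
    _ ≤ θ * P[X] + 128 * θ ^ 2 + 1 := by nlinarith [sq_nonneg θ]
    _ ≤ exp (θ * P[X] + 128 * θ ^ 2) := add_one_le_exp _

theorem measureReal_card_mul_le_sum_sub_le {ι : Type*} [Fintype ι] {X : ι → Ω → ℝ}
    (hind : iIndepFun X P) (hX : ∀ i, Integrable (X i) P)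
    (hcosh : ∀ i, Integrable (fun ω => cosh (X i ω / 2)) P)
    (hle : ∀ i, ∫ ω, cosh (X i ω / 2) ∂P ≤ 2) {t : ℝ} (ht₀ : 0 ≤ t) (ht : t ≤ 64) :
    P.real {ω | Fintype.card ι * t ≤ ∑ i, X i ω - ∑ i, P[X i]} ≤
      exp (-(Fintype.card ι * t ^ 2 / 512)) := by
  set θ := t / 256 with hθ_def
  have hθ₀ : 0 ≤ θ := by positivity
  have hθ : |θ| ≤ 1 / 4 := by
    rw [abs_of_nonneg hθ₀]
    linarith
  have hmgf_sum := hind.mgf_sum₀ (t := θ) (fun i => (hX i).aemeasurable) Finset.univ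
  have hint : Integrable (fun ω => exp (θ * (∑ i, X i) ω)) P := by
    by_contra hnot
    refine (Finset.prod_pos fun i _ => ?_).ne' (hmgf_sum.symm.trans (mgf_undef hnot))
    exact mgf_pos (integrable_exp_mul_of_integrable_cosh (hX i).aemeasurable (hcosh i) hθ)
  calc P.real {ω | Fintype.card ι * t ≤ ∑ i, X i ω - ∑ i, P[X i]}
      = P.real {ω | Fintype.card ι * t + ∑ i, P[X i] ≤ (∑ i, X i) ω} := by
        simp only [Finset.sum_apply, le_sub_iff_add_le]
    _ ≤ exp (-θ * (Fintype.card ι * t + ∑ i, P[X i])) * ∏ i, mgf (X i) P θ :=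
        (measure_ge_le_exp_mul_mgf _ hθ₀ hint).trans_eq (by rw [hmgf_sum])
    _ ≤ exp (-θ * (Fintype.card ι * t + ∑ i, P[X i])) *
          ∏ i, exp (θ * P[X i] + 128 * θ ^ 2) := by
        gcongr with i
        · exact fun _ _ => mgf_nonneg
        · exact mgf_le_of_integral_cosh_le_two (hX i) (hcosh i) (hle i) hθ
    _ = exp (-(Fintype.card ι * t ^ 2 / 512)) := by
        rw [← exp_sum, ← exp_add, Finset.sum_add_distrib, ← Finset.mul_sum, Finset.sum_const,
          Finset.card_univ, nsmul_eq_mul, hθ_def]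
        ring_nf

theorem measureReal_card_mul_le_abs_sum_sub_le {ι : Type*} [Fintype ι] {X : ι → Ω → ℝ}
    (hind : iIndepFun X P) (hX : ∀ i, Integrable (X i) P)
    (hcosh : ∀ i, Integrable (fun ω => cosh (X i ω / 2)) P)
    (hle : ∀ i, ∫ ω, cosh (X i ω / 2) ∂P ≤ 2) {t : ℝ} (ht₀ : 0 ≤ t) (ht : t ≤ 64) :
    P.real {ω | Fintype.card ι * t ≤ |∑ i, X i ω - ∑ i, P[X i]|} ≤
      2 * exp (-(Fintype.card ι * t ^ 2 / 512)) := by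
  have hupper := measureReal_card_mul_le_sum_sub_le hind hX hcosh hle ht₀ ht
  have hlower := measureReal_card_mul_le_sum_sub_le (X := fun i => -X i)
    (hind.comp (fun _ x => -x) fun _ => measurable_neg) (fun i => (hX i).neg)
    (by simpa only [Pi.neg_apply, neg_div, cosh_neg] using hcosh)
    (by simpa only [Pi.neg_apply, neg_div, cosh_neg] using hle) ht₀ ht
  simp only [le_abs, Set.ofPred_or]
  refine (measureReal_union_le _ _).trans ?_
  simp only [Pi.neg_apply, integral_neg, Finset.sum_neg_distrib] at hlower
  rw [two_mul]
  refine add_le_add hupper ?_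
  refine hlower.trans_eq' ?_
  congr with ω
  rw [neg_sub', sub_neg_eq_add]

variable {α : Type*} [MeasurableSpace α] {μ : Measure α}

theorem measureReal_le_abs_sum_sub_integral_le {n : ℕ} {ψ : Fin n → Ω → α}
    (hind : iIndepFun ψ P) (hlaw : ∀ i, HasLaw (ψ i) μ P) {f : α → ℝ} (hf : Measurable f)
    (hf_int : Integrable f μ) (hcosh : Integrable (fun x => cosh (f x / 2)) μ)
    (hle : ∫ x, cosh (f x / 2) ∂μ ≤ 2) {t : ℝ} (ht₀ : 0 ≤ t) (ht : t ≤ 64) :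
    P.real {ω | n * t ≤ |∑ i, f (ψ i ω) - n * ∫ x, f x ∂μ|} ≤ 2 * exp (-(n * t ^ 2 / 512)) := by
  have hmean : ∀ i, ∫ ω, f (ψ i ω) ∂P = ∫ x, f x ∂μ := fun i =>
    (hlaw i).integral_comp hf_int.aestronglyMeasurable
  have htransfer : ∀ i, ∀ g : α → ℝ, Integrable g μ → Integrable (g ∘ ψ i) P := fun i g hg =>
    ((hlaw i).map_eq ▸ hg).comp_aemeasurable (hlaw i).aemeasurable
  have hbound := measureReal_card_mul_le_abs_sum_sub_le (X := fun i ω => f (ψ i ω))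
    (hind.comp (fun _ => f) fun _ => hf) (fun i => htransfer i f hf_int)
    (fun i => htransfer i _ hcosh)
    (fun i => ((hlaw i).integral_comp hcosh.aestronglyMeasurable).trans_le hle) ht₀ ht
  simpa only [hmean, Finset.sum_const, Finset.card_univ, Fintype.card_fin, nsmul_eq_mul]
    using hbound

end Concentration

section Nets

open Module Metric

section Volume

variable {V : Type*} [NormedAddCommGroup V] [NormedSpace ℝ V] [FiniteDimensional ℝ V]

theorem card_le_of_isSeparated {δ : NNReal} (hδ : 0 < δ) {s : Finset V}
    (hs : (s : Set V) ⊆ closedBall 0 1) (hsep : IsSeparated δ (s : Set V)) :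
    (s.card : ℝ) ≤ (1 + 2 / δ) ^ finrank ℝ V := by
  borelize V
  let μ : Measure V := Measure.addHaar
  have hδ' : (0 : ℝ) < δ := hδ
  have hdisj :
      Set.Pairwise (s : Set V) (Function.onFun Disjoint fun c => closedBall c (δ / 2)) := by
    intro c hc e he hce
    refine closedBall_disjoint_closedBall ?_
    have hlt : (δ : ENNReal) < edist c e := hsep hc he hce
    rw [edist_nndist, ENNReal.coe_lt_coe, ← NNReal.coe_lt_coe, coe_nndist] at hlt
    linarith
  have hsub : (⋃ c ∈ s, closedBall c (δ / 2)) ⊆ closedBall (0 : V) (1 + δ / 2) :=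
    Set.iUnion₂_subset fun c hc =>
      closedBall_subset_closedBall' (by linarith [mem_closedBall.1 (hs hc)])
  have hvol : (s.card : ℝ) * (δ / 2) ^ finrank ℝ V * μ.real (ball 0 1) ≤
      (1 + δ / 2) ^ finrank ℝ V * μ.real (ball 0 1) :=
    calc (s.card : ℝ) * (δ / 2) ^ finrank ℝ V * μ.real (ball 0 1)
        = μ.real (⋃ c ∈ s, closedBall c (δ / 2)) := by
          rw [measureReal_biUnion_finset hdisj (fun c _ => measurableSet_closedBall)
            fun c _ => measure_closedBall_lt_top.ne]
          simp only [μ.addHaar_real_closedBall _ (half_pos hδ').le, Finset.sum_const, nsmul_eq_mul,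
            mul_assoc]
      _ ≤ μ.real (closedBall 0 (1 + δ / 2)) :=
          measureReal_mono hsub measure_closedBall_lt_top.ne
      _ = (1 + δ / 2) ^ finrank ℝ V * μ.real (ball 0 1) :=
          μ.addHaar_real_closedBall _ (by positivity)
  have hpos : 0 < μ.real (ball 0 1) :=
    ENNReal.toReal_pos (measure_ball_pos _ _ one_pos).ne' measure_ball_lt_top.ne
  have hratio : (1 + 2 / δ : ℝ) = (1 + δ / 2) / (δ / 2) := by
    field_simp
    ring
  rw [hratio, div_pow, le_div_iff₀ (by positivity)]
  exact le_of_mul_le_mul_right hvol hpos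

theorem packingNumber_closedBall_le {δ : NNReal} (hδ : 0 < δ) :
    packingNumber δ (closedBall (0 : V) 1) ≤ (⌊(1 + 2 / δ : ℝ) ^ finrank ℝ V⌋₊ : ℕ∞) := by
  refine iSup₂_le fun s hs => iSup_le fun hsep => ?_
  by_contra! hlt
  obtain ⟨t, hts, ht⟩ := Set.exists_subset_encard_eq (Order.add_one_le_of_lt hlt)
  have htfin : t.Finite := Set.finite_of_encard_eq_coe ht
  lift t to Finset V using htfin
  rw [Set.encard_coe_eq_coe_finsetCard] at ht
  have hcard := Nat.le_floor (card_le_of_isSeparated hδ (hts.trans hs) (hsep.subset hts))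
  have : t.card = ⌊(1 + 2 / δ : ℝ) ^ finrank ℝ V⌋₊ + 1 := by exact_mod_cast ht
  omega

theorem exists_finset_isCover_closedBall {δ : NNReal} (hδ : 0 < δ) :
    ∃ N : Finset V, (N : Set V) ⊆ closedBall 0 1 ∧ IsCover δ (closedBall 0 1) (N : Set V) ∧
      (N.card : ℝ) ≤ (1 + 2 / δ) ^ finrank ℝ V := by
  have hle := packingNumber_closedBall_le (V := V) hδ
  have htop := ne_top_of_le_ne_top (ENat.natCast_ne_top _) hle
  have hfin : (maximalSeparatedSet δ (closedBall (0 : V) 1)).Finite :=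
    Set.encard_ne_top_iff.1 (by rwa [encard_maximalSeparatedSet htop])
  refine ⟨hfin.toFinset, ?_, ?_, card_le_of_isSeparated hδ ?_ ?_⟩ <;> rw [hfin.coe_toFinset]
  · exact maximalSeparatedSet_subset
  · exact isCover_maximalSeparatedSet htop
  · exact maximalSeparatedSet_subset
  · exact isSeparated_maximalSeparatedSet

end Volume

variable {V : Type*} [AddCommGroup V] [Module ℝ V]

/-- A finite set `N` is a `δ`-net of the closed unit ball of the seminorm `p`. -/
structure IsNet (p : Seminorm ℝ V) (δ : ℝ) (N : Finset V) : Prop where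
  le_one : ∀ x ∈ N, p x ≤ 1
  exists_sub_le : ∀ y, p y ≤ 1 → ∃ x ∈ N, p (y - x) ≤ δ

theorem exists_isNet_card_le [FiniteDimensional ℝ V] {p : Seminorm ℝ V}
    (hp : ∀ x, p x = 0 → x = 0) {δ : ℝ} (hδ : 0 < δ) :
    ∃ N : Finset V, IsNet p δ N ∧ (N.card : ℝ) ≤ (1 + 2 / δ) ^ finrank ℝ V := by
  let : Norm V := ⟨p⟩
  have core : NormedSpace.Core ℝ V :=
    { norm_nonneg := apply_nonneg p
      norm_smul := map_smul_eq_mul p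
      norm_triangle := map_add_le_add p
      norm_eq_zero_iff := fun x => ⟨hp x, fun hx => hx ▸ map_zero p⟩ }
  let : NormedAddCommGroup V := .ofCore core
  let : NormedSpace ℝ V := .ofCore core
  lift δ to NNReal using hδ.le
  obtain ⟨N, hN, hcover, hcard⟩ := exists_finset_isCover_closedBall (V := V) (by exact_mod_cast hδ)
  refine ⟨N, ⟨fun x hx => mem_closedBall_zero_iff.1 (hN hx), fun y hy => ?_⟩, hcard⟩
  obtain ⟨x, hx, hxy⟩ := hcover (mem_closedBall_zero_iff.2 hy)
  refine ⟨x, hx, ?_⟩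
  have hdist : dist y x ≤ δ := by
    rwa [← coe_nndist, NNReal.coe_le_coe, ← ENNReal.coe_le_coe, ← edist_nndist]
  rwa [dist_eq_norm] at hdist

theorem le_mul_of_forall_le_one {p : Seminorm ℝ V} {f : V → ℝ}
    (hf : ∀ c : ℝ, 0 ≤ c → ∀ x, f (c • x) = c * f x) (hker : ∀ x, p x = 0 → f x ≤ 0) {a : ℝ}
    (h : ∀ x, p x ≤ 1 → f x ≤ a) (x : V) : f x ≤ a * p x := by
  rcases (apply_nonneg p x).eq_or_lt with hx | hx
  · rw [← hx, mul_zero]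
    exact hker x hx.symm
  · have hunit := h ((p x)⁻¹ • x) <| by
      rw [map_smul_eq_mul, norm_of_nonneg (by positivity), inv_mul_cancel₀ hx.ne']
    rwa [hf _ (by positivity), inv_mul_le_iff₀ hx, mul_comm] at hunit

namespace IsNet

variable {p q : Seminorm ℝ V} {δ a K : ℝ} {N : Finset V}

theorem le_mul (hN : IsNet p δ N) (hδ : δ < 1) (hqp : ∀ x, q x ≤ K * p x)
    (hq : ∀ x ∈ N, q x ≤ a) (x : V) : q x ≤ a / (1 - δ) * p x := by
  obtain ⟨x₀, hx₀, hx₀δ⟩ := hN.exists_sub_le 0 (by simp)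
  have hδ₀ : 0 ≤ δ := (apply_nonneg p _).trans hx₀δ
  have ha : 0 ≤ a := (apply_nonneg q _).trans (hq x₀ hx₀)
  have himprove : ∀ M, 0 ≤ M → (∀ x, q x ≤ M * p x) → ∀ x, q x ≤ (a + δ * M) * p x := by
    intro M hM hqM
    refine le_mul_of_forall_le_one (fun c hc x => ?_) (fun x hx => ?_) fun y hy => ?_
    · rw [map_smul_eq_mul, norm_of_nonneg hc]
    · simpa only [hx, mul_zero] using hqM x
    · obtain ⟨x, hx, hxy⟩ := hN.exists_sub_le y hy
      have hsub : q y ≤ q x + q (y - x) := by simpa using map_add_le_add q x (y - x)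
      nlinarith [hq x hx, hqM (y - x)]
  set S := {M : ℝ | 0 ≤ M ∧ ∀ x, q x ≤ M * p x} with hS
  have hSclosed : IsClosed S := by
    simp only [hS, Set.ofPred_and, Set.ofPred_forall]
    exact isClosed_Ici.inter (isClosed_iInter fun x => isClosed_le (by fun_prop) (by fun_prop))
  have hSbdd : BddBelow S := ⟨0, fun M hM => hM.1⟩
  have hSne : S.Nonempty := ⟨max K 0, le_max_right _ _, fun x => (hqp x).trans <|
    mul_le_mul_of_nonneg_right (le_max_left _ _) (apply_nonneg p x)⟩
  obtain ⟨hm, hqm⟩ := hSclosed.csInf_mem hSne hSbdd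
  have hfix : sInf S ≤ a + δ * sInf S :=
    csInf_le hSbdd ⟨by positivity, himprove _ hm hqm⟩
  refine (hqm x).trans (mul_le_mul_of_nonneg_right ?_ (apply_nonneg p x))
  rw [le_div_iff₀ (by linarith)]
  linarith

theorem abs_sub_le_mul (hN : IsNet p δ N) (hqp : ∀ x, q x ≤ K * p x) (hK : 0 ≤ K)
    (hq : ∀ x ∈ N, |q x - p x| ≤ a) (x : V) : |q x - p x| ≤ (a + (K + 1) * δ) * p x := by
  refine le_mul_of_forall_le_one (f := fun x => |q x - p x|) (fun c hc x => ?_)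
    (fun x hx => ?_) (fun y hy => ?_) x
  · rw [map_smul_eq_mul, map_smul_eq_mul, norm_of_nonneg hc, ← mul_sub, abs_mul, abs_of_nonneg hc]
  · have hqx : q x = 0 := le_antisymm ((hqp x).trans_eq (by rw [hx, mul_zero])) (apply_nonneg q x)
    rw [hqx, hx, sub_zero, abs_zero]
  · obtain ⟨x, hx, hxy⟩ := hN.exists_sub_le y hy
    have hq_sub := abs_le.1 (abs_sub_map_le_sub q y x)
    have hp_sub := abs_le.1 (abs_sub_map_le_sub p y x)
    have hx_le := abs_le.1 (hq x hx)
    have hK_le : q (y - x) ≤ K * δ := (hqp _).trans (mul_le_mul_of_nonneg_left hxy hK)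
    exact abs_le.2 ⟨by linarith, by linarith⟩

end IsNet

end Nets

section Povm

open Matrix

theorem inv_real_smul {m : Type*} [Fintype m] [DecidableEq m] {r : ℝ} (hr : r ≠ 0)
    (A : Matrix m m ℂ) : (r • A)⁻¹ = r⁻¹ • A⁻¹ := by
  by_cases hA : IsUnit A.det
  · refine inv_eq_left_inv ?_
    rw [smul_mul_smul_comm, inv_mul_cancel₀ hr, nonsing_inv_mul A hA, one_smul]
  · have hrA : ¬IsUnit (r • A).det := by
      rw [← Complex.coe_smul, det_smul, isUnit_iff_ne_zero] at *
      simpa [hr] using hA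
    rw [nonsing_inv_apply_not_isUnit _ hA, nonsing_inv_apply_not_isUnit _ hrA, smul_zero]

variable {d n : ℕ} (M : Fin n → Matrix (Fin d) (Fin d) ℂ)

/-- The functional `Δ ↦ ∑ i, |tr (Δ M_i)|` of an arbitrary finite family `M`, bundled as a
seminorm. -/
def povmSeminorm : Seminorm ℂ (Matrix (Fin d) (Fin d) ℂ) :=
  .of (povmNorm M)
    (fun A B => by
      simp only [povmNorm, add_mul, trace_add, ← Finset.sum_add_distrib]
      exact Finset.sum_le_sum fun i _ => norm_add_le _ _)
    (fun c A => by
      simp only [povmNorm, smul_mul_assoc, trace_smul, norm_smul, Finset.mul_sum])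

theorem povmSeminorm_apply (Δ : Matrix (Fin d) (Fin d) ℂ) : povmSeminorm M Δ = povmNorm M Δ := rfl

theorem norm_trace_mul_sum_le (Δ : Matrix (Fin d) (Fin d) ℂ) :
    ‖(Δ * ∑ i, M i).trace‖ ≤ povmSeminorm M Δ := by
  rw [Finset.mul_sum, trace_sum, povmSeminorm_apply]
  exact norm_sum_le _ _

/-- The family `(S^{-1/2} M_i S^{-1/2})_i` with `S = ∑ i, M_i`, for positive semidefinite `M_i`. It
is a POVM whenever `S` is invertible. -/
def normalized (i : Fin n) : Matrix (Fin d) (Fin d) ℂ :=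
  (CFC.sqrt (∑ j, M j))⁻¹ * M i * (CFC.sqrt (∑ j, M j))⁻¹

theorem povmNorm_normalized (Δ : Matrix (Fin d) (Fin d) ℂ) :
    povmNorm (normalized M) Δ =
      povmSeminorm M ((CFC.sqrt (∑ j, M j))⁻¹ * Δ * (CFC.sqrt (∑ j, M j))⁻¹) := by
  rw [povmSeminorm_apply]
  refine Finset.sum_congr rfl fun i _ => ?_
  rw [normalized, ← mul_assoc, trace_mul_comm, ← mul_assoc, ← mul_assoc]

variable {M} (hM : ∀ i, (M i).PosSemidef)
include hM

theorem sum_nonneg_of_posSemidef : 0 ≤ ∑ i, M i :=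
  nonneg_iff_posSemidef.2 (posSemidef_sum _ fun i _ => hM i)

theorem normalized_smul {c : ℝ} (hc : 0 < c) : normalized (fun i => c • M i) = normalized M := by
  have hsqrt : CFC.sqrt (∑ i, c • M i) = √c • CFC.sqrt (∑ i, M i) := by
    rw [← Finset.smul_sum]
    refine (CFC.sqrt_eq_iff _ _ (smul_nonneg hc.le (sum_nonneg_of_posSemidef hM))
      (smul_nonneg (sqrt_nonneg c) (CFC.sqrt_nonneg _))).2 ?_
    rw [smul_mul_smul_comm, mul_self_sqrt hc.le,
      CFC.sqrt_mul_sqrt_self _ (sum_nonneg_of_posSemidef hM)]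
  funext i
  rw [normalized, normalized, hsqrt, inv_real_smul (sqrt_pos.2 hc).ne', mul_smul_comm,
    smul_mul_smul_comm, smul_mul_assoc, smul_smul, ← mul_assoc, ← mul_inv, mul_self_sqrt hc.le,
    inv_mul_cancel₀ hc.ne', one_smul]

theorem isDiscretePOVM_normalized (hS : IsUnit (CFC.sqrt (∑ i, M i))) :
    IsDiscretePOVM (normalized M) := by
  have hdet := (isUnit_iff_isUnit_det _).1 hS
  have hR : ((CFC.sqrt (∑ i, M i))⁻¹).IsHermitian :=
    (nonneg_iff_posSemidef.1 (CFC.sqrt_nonneg _)).isHermitian.inv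
  refine ⟨fun i => ?_, ?_⟩
  · have h := (hM i).mul_mul_conjTranspose_same (CFC.sqrt (∑ i, M i))⁻¹
    rwa [hR.eq] at h
  · simp only [normalized]
    rw [← Finset.sum_mul, ← Finset.mul_sum]
    conv_lhs => enter [1, 2]; rw [← CFC.sqrt_mul_sqrt_self _ (sum_nonneg_of_posSemidef hM)]
    rw [nonsing_inv_mul_cancel_left _ _ hdet, mul_nonsing_inv _ hdet]

end Povm

section Normalization

open Matrix
open scoped Matrix.Norms.Frobenius

theorem isUnit_and_norm_inv_sub_one_le {m 𝕜 : Type*} [Fintype m] [DecidableEq m] [RCLike 𝕜]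
    {A : Matrix m m 𝕜} (h : ‖A - 1‖ ≤ 1 / 2) : IsUnit A ∧ ‖A⁻¹ - 1‖ ≤ 2 * ‖A - 1‖ := by
  have : CompleteSpace (Matrix m m 𝕜) := FiniteDimensional.complete 𝕜 _
  have hA : IsUnit A := by
    have hlt : ‖1 - A‖ < 1 := by
      rw [norm_sub_rev]
      linarith
    simpa only [sub_sub_cancel] using isUnit_one_sub_of_norm_lt_one hlt
  exact ⟨hA, norm_sub_one_le_of_mul_eq_one
    (mul_nonsing_inv A ((isUnit_iff_isUnit_det A).1 hA)) h⟩

variable {d n : ℕ} [NeZero d] {e : ℝ}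

theorem norm_le_of_forall_re_trace_mul_le {H : Matrix (Fin d) (Fin d) ℂ} (hH : H.IsHermitian)
    (htr : H.trace = 0) (he : ∀ Δ, |(Δ * H).trace.re| ≤ e * uniformSeminorm d Δ) :
    ‖H‖ ≤ 2 * e := by
  have hself : (H * H).trace.re = ‖H‖ ^ 2 := by
    have h := trace_mul_conjTranspose_self H
    rw [hH.eq] at h
    rw [h]
    exact Complex.ofReal_re _
  have hle := he H
  have hU := uniformSeminorm_le H
  have he₀ : 0 ≤ e := by
    have h1 := (abs_nonneg _).trans (he 1)
    have h2 := norm_trace_le_uniformSeminorm (1 : Matrix (Fin d) (Fin d) ℂ)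
    rw [trace_one, Fintype.card_fin, Complex.norm_natCast] at h2
    have hd : (0 : ℝ) < d := by exact_mod_cast NeZero.pos d
    exact nonneg_of_mul_nonneg_left h1 (hd.trans_le h2)
  rw [hself, abs_of_nonneg (sq_nonneg _)] at hle
  rw [htr, norm_zero, zero_add] at hU
  rcases (norm_nonneg H).eq_or_lt with h0 | hpos
  · rw [← h0]
    positivity
  · nlinarith

theorem uniformSeminorm_mul_mul_sub_le (A : Matrix (Fin d) (Fin d) ℂ)
    {R : Matrix (Fin d) (Fin d) ℂ} (hR : ‖R - 1‖ ≤ 1) :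
    uniformSeminorm d (R * A * R - A) ≤ 12 * ‖R - 1‖ * ‖A‖ := by
  have hquad : 2 * ‖R - 1‖ + ‖R - 1‖ ^ 2 ≤ 3 * ‖R - 1‖ := by nlinarith [norm_nonneg (R - 1)]
  have hscale := mul_le_mul_of_nonneg_right hquad (norm_nonneg A)
  linarith [uniformSeminorm_le (R * A * R - A), norm_trace_mul_mul_sub_le A R,
    norm_mul_mul_sub_le A R]

theorem isDiscretePOVM_normalized_and_abs_sub_le_of_forall {M : Fin n → Matrix (Fin d) (Fin d) ℂ}
    (hM : ∀ i, (M i).PosSemidef) (htr : (∑ i, M i).trace = d) (he : e ≤ 1 / 4)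
    (hnorm : ∀ Δ, |povmSeminorm M Δ - uniformSeminorm d Δ| ≤ e * uniformSeminorm d Δ)
    (hsum : ∀ Δ, |(Δ * (∑ i, M i - 1)).trace.re| ≤ e * uniformSeminorm d Δ) :
    IsDiscretePOVM (normalized M) ∧ ∀ Δ,
      |povmNorm (normalized M) Δ - uniformNorm d Δ| ≤ 50000 * e * uniformNorm d Δ := by
  set S := ∑ i, M i
  have hdefect : ‖S - 1‖ ≤ 2 * e :=
    norm_le_of_forall_re_trace_mul_le
      ((posSemidef_sum _ fun i _ => hM i).isHermitian.sub isHermitian_one)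
      (by rw [trace_sub, htr, trace_one, Fintype.card_fin, sub_self]) hsum
  have hsqrt : ‖CFC.sqrt S - 1‖ ≤ 2 * e := by
    have h := norm_sub_one_le_norm_mul_self_sub_one
      (nonneg_iff_posSemidef.1 (CFC.sqrt_nonneg S))
    rw [CFC.sqrt_mul_sqrt_self _ (sum_nonneg_of_posSemidef hM)] at h
    exact h.trans hdefect
  obtain ⟨hunit, hinv⟩ := isUnit_and_norm_inv_sub_one_le (hsqrt.trans (by linarith))
  refine ⟨isDiscretePOVM_normalized hM hunit, fun Δ => ?_⟩
  set R := (CFC.sqrt S)⁻¹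
  set U := uniformSeminorm d
  have hR : ‖R - 1‖ ≤ 4 * e := by linarith
  have he₀ : 0 ≤ e := by linarith [norm_nonneg (S - 1)]
  have hdiff : U (R * Δ * R - Δ) ≤ 25000 * e * U Δ :=
    calc U (R * Δ * R - Δ) ≤ 12 * ‖R - 1‖ * ‖Δ‖ :=
          uniformSeminorm_mul_mul_sub_le Δ (by linarith)
      _ ≤ 12 * (4 * e) * (512 * U Δ) := by gcongr; exact frobenius_norm_le_uniformSeminorm Δ
      _ ≤ 25000 * e * U Δ := by nlinarith [mul_nonneg he₀ (apply_nonneg U Δ)]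
  have hsub : |U (R * Δ * R) - U Δ| ≤ U (R * Δ * R - Δ) := abs_sub_map_le_sub U _ _
  rw [povmNorm_normalized, ← uniformSeminorm_apply]
  calc |povmSeminorm M (R * Δ * R) - U Δ|
      ≤ |povmSeminorm M (R * Δ * R) - U (R * Δ * R)| + |U (R * Δ * R) - U Δ| := abs_sub_le _ _ _
    _ ≤ e * (U Δ + U (R * Δ * R - Δ)) + U (R * Δ * R - Δ) := by
        gcongr
        refine (hnorm _).trans (mul_le_mul_of_nonneg_left ?_ he₀)
        linarith [(abs_le.1 hsub).2]
    _ ≤ 50000 * e * U Δ := by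
        nlinarith [mul_nonneg he₀ (apply_nonneg U Δ), apply_nonneg U (R * Δ * R - Δ)]

theorem povmSeminorm_le (M : Fin n → Matrix (Fin d) (Fin d) ℂ) (Δ : Matrix (Fin d) (Fin d) ℂ) :
    povmSeminorm M Δ ≤ 512 * (∑ i, ‖M i‖) * uniformSeminorm d Δ :=
  calc ∑ i, ‖(Δ * M i).trace‖ ≤ ∑ i, ‖Δ‖ * ‖M i‖ :=
        Finset.sum_le_sum fun i _ => norm_trace_mul_le Δ (M i)
    _ = (∑ i, ‖M i‖) * ‖Δ‖ := by rw [← Finset.mul_sum, mul_comm]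
    _ ≤ (∑ i, ‖M i‖) * (512 * uniformSeminorm d Δ) := by
        gcongr
        exact frobenius_norm_le_uniformSeminorm Δ
    _ = 512 * (∑ i, ‖M i‖) * uniformSeminorm d Δ := by ring

/-- The seminorm `Δ ↦ |Re tr (Δ (∑ i, M_i - 1))|`, measuring how far the family `M` is from
summing to the identity. -/
def defectSeminorm {d n : ℕ} (M : Fin n → Matrix (Fin d) (Fin d) ℂ) :
    Seminorm ℝ (Matrix (Fin d) (Fin d) ℂ) :=
  (normSeminorm ℝ ℝ).comp
    (Complex.reLm ∘ₗ traceLinearMap (Fin d) ℝ ℂ ∘ₗ LinearMap.mulRight ℝ (∑ i, M i - 1))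

theorem defectSeminorm_apply {d n : ℕ} (M : Fin n → Matrix (Fin d) (Fin d) ℂ)
    (Δ : Matrix (Fin d) (Fin d) ℂ) :
    defectSeminorm M Δ = |(Δ * (∑ i, M i - 1)).trace.re| := rfl

theorem defectSeminorm_le (M : Fin n → Matrix (Fin d) (Fin d) ℂ)
    (Δ : Matrix (Fin d) (Fin d) ℂ) :
    defectSeminorm M Δ ≤ povmSeminorm M Δ + uniformSeminorm d Δ := by
  rw [defectSeminorm_apply, mul_sub, mul_one, trace_sub]
  exact (Complex.abs_re_le_norm _).trans <| (norm_sub_le _ _).trans <|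
    add_le_add (norm_trace_mul_sum_le M Δ) (norm_trace_le_uniformSeminorm Δ)

theorem isDiscretePOVM_normalized_and_abs_sub_le_of_isNet
    {M : Fin n → Matrix (Fin d) (Fin d) ℂ} (hM : ∀ i, (M i).PosSemidef)
    (htr : (∑ i, M i).trace = d) {δ : ℝ} {N : Finset (Matrix (Fin d) (Fin d) ℂ)}
    (hN : IsNet ((uniformSeminorm d).restrictScalars ℝ) δ N) (hδ₀ : 0 ≤ δ) (hδ : δ ≤ 1 / 16)
    (hnorm : ∀ Δ ∈ N, |povmSeminorm M Δ - uniformSeminorm d Δ| ≤ δ)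
    (hsum : ∀ Δ ∈ N, defectSeminorm M Δ ≤ δ) :
    IsDiscretePOVM (normalized M) ∧ ∀ Δ,
      |povmNorm (normalized M) Δ - uniformNorm d Δ| ≤ 200000 * δ * uniformNorm d Δ := by
  set U := uniformSeminorm d
  have hbound_net : ∀ Δ ∈ N, povmSeminorm M Δ ≤ 1 + δ := fun Δ hΔ => by
    have hle_one : U Δ ≤ 1 := hN.le_one Δ hΔ
    linarith [(abs_le.1 (hnorm Δ hΔ)).2]
  have hbound : ∀ Δ, povmSeminorm M Δ ≤ 2 * U Δ := fun Δ => by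
    have h := hN.le_mul (q := (povmSeminorm M).restrictScalars ℝ) (by linarith)
      (povmSeminorm_le M) hbound_net Δ
    refine h.trans (mul_le_mul_of_nonneg_right ?_ (apply_nonneg U Δ))
    rw [div_le_iff₀] <;> linarith
  have hdefect_le : ∀ Δ, defectSeminorm M Δ ≤ 3 * U Δ := fun Δ => by
    linarith [defectSeminorm_le M Δ, hbound Δ]
  have hdefect : ∀ Δ, defectSeminorm M Δ ≤ 4 * δ * U Δ := fun Δ => by
    refine (hN.le_mul (by linarith) hdefect_le hsum Δ).trans
      (mul_le_mul_of_nonneg_right ?_ (apply_nonneg U Δ))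
    rw [div_le_iff₀] <;> nlinarith
  have hclose_net : ∀ Δ, |povmSeminorm M Δ - U Δ| ≤ 4 * δ * U Δ := fun Δ => by
    have h := hN.abs_sub_le_mul (q := (povmSeminorm M).restrictScalars ℝ) hbound two_pos.le hnorm Δ
    rwa [show δ + (2 + 1) * δ = 4 * δ by ring] at h
  obtain ⟨hpovm, hclose⟩ := isDiscretePOVM_normalized_and_abs_sub_le_of_forall hM htr
    (by linarith : 4 * δ ≤ 1 / 4) hclose_net hdefect
  exact ⟨hpovm, fun Δ => (hclose Δ).trans_eq (by ring)⟩

end Normalization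

section Empirical

open Matrix

theorem posSemidef_proj {d : ℕ} (ψ : UnitSphere d) : (proj ψ).PosSemidef :=
  posSemidef_vecMulVec_self_star _

theorem trace_mul_proj {d : ℕ} (Δ : Matrix (Fin d) (Fin d) ℂ) (ψ : UnitSphere d) :
    (Δ * proj ψ).trace = quadForm Δ ψ :=
  (quadForm_eq_trace Δ (ψ : EuclideanSpace ℂ (Fin d))).symm

theorem trace_proj {d : ℕ} (ψ : UnitSphere d) : (proj ψ).trace = 1 := by
  have hnorm := inner_self_eq_norm_sq_to_K (𝕜 := ℂ) (ψ : EuclideanSpace ℂ (Fin d))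
  rw [norm_eq_of_mem_sphere, EuclideanSpace.inner_eq_star_dotProduct] at hnorm
  rw [proj, trace_vecMulVec]
  simpa [coords] using hnorm

variable {d n : ℕ} (ψ : Fin n → UnitSphere d)

/-- The family `((d / n) |ψ_i⟩⟨ψ_i|)_i`, i.e. `d` times the empirical distribution of the `ψ_i`: a
random approximation of the uniform POVM that need not sum to the identity. -/
def empiricalFamily (i : Fin n) : Matrix (Fin d) (Fin d) ℂ := (d / n : ℝ) • proj (ψ i)

theorem posSemidef_empiricalFamily (i : Fin n) : (empiricalFamily ψ i).PosSemidef :=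
  (posSemidef_proj (ψ i)).smul (by positivity)

theorem trace_mul_empiricalFamily (Δ : Matrix (Fin d) (Fin d) ℂ) (i : Fin n) :
    (Δ * empiricalFamily ψ i).trace = (d / n : ℝ) * quadForm Δ (ψ i) := by
  rw [empiricalFamily, mul_smul_comm, trace_smul, trace_mul_proj, Complex.real_smul]

theorem povmSeminorm_empiricalFamily (Δ : Matrix (Fin d) (Fin d) ℂ) :
    povmSeminorm (empiricalFamily ψ) Δ = d / n * ∑ i, ‖quadForm Δ (ψ i)‖ := by
  rw [povmSeminorm_apply, povmNorm, Finset.mul_sum]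
  refine Finset.sum_congr rfl fun i _ => ?_
  rw [trace_mul_empiricalFamily, norm_mul, Complex.norm_of_nonneg (by positivity)]

theorem defectSeminorm_empiricalFamily (Δ : Matrix (Fin d) (Fin d) ℂ) :
    defectSeminorm (empiricalFamily ψ) Δ =
      |d / n * ∑ i, (quadForm Δ (ψ i)).re - Δ.trace.re| := by
  simp only [defectSeminorm_apply, mul_sub, Finset.mul_sum, mul_one, trace_sub, trace_sum,
    trace_mul_empiricalFamily, Complex.sub_re, Complex.re_sum, Complex.re_ofReal_mul]

variable [NeZero n]

theorem trace_sum_empiricalFamily : (∑ i, empiricalFamily ψ i).trace = d := by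
  have hn : (n : ℂ) ≠ 0 := by exact_mod_cast NeZero.ne n
  simp only [trace_sum, empiricalFamily, trace_smul, trace_proj, Finset.sum_const,
    Finset.card_univ, Fintype.card_fin, Complex.real_smul, nsmul_eq_mul]
  push_cast
  field_simp

theorem normalized_empiricalFamily [NeZero d] :
    normalized (empiricalFamily ψ) = randomPOVM ψ := by
  have hd : (0 : ℝ) < d := by exact_mod_cast NeZero.pos d
  have hn : (0 : ℝ) < n := by exact_mod_cast NeZero.pos n
  exact normalized_smul (fun i => posSemidef_proj (ψ i)) (div_pos hd hn)

end Empirical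

section UnionBound

open Matrix
open scoped Matrix.Norms.Frobenius

variable {d n : ℕ} [NeZero d] [NeZero n] {Ω : Type*} [MeasurableSpace Ω] {P : Measure Ω}
  [IsProbabilityMeasure P] {ψ : Fin n → Ω → UnitSphere d} {δ : ℝ}

theorem measureReal_le_abs_mul_sum_sub_integral_le (hind : iIndepFun ψ P)
    (hlaw : ∀ i, HasLaw (ψ i) (uniformSphere d) P) {f : UnitSphere d → ℝ} (hf : Continuous f)
    (hcosh : ∫ x, cosh (d * f x / 1026 / 2) ∂(uniformSphere d) ≤ 2) (hδ₀ : 0 ≤ δ) (hδ : δ ≤ 1) :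
    P.real {ω | δ ≤ |d / n * ∑ i, f (ψ i ω) - d * ∫ x, f x ∂(uniformSphere d)|} ≤
      2 * exp (-(n * (δ / 1026) ^ 2 / 512)) := by
  have hn : (0 : ℝ) < n := by exact_mod_cast NeZero.pos n
  have := continuous_cosh
  refine (measureReal_le_abs_sum_sub_integral_le hind hlaw
    (f := fun x => d * f x / 1026) (Continuous.measurable (by fun_prop))
    (integrable_of_continuous_sphere (by fun_prop))
    (integrable_of_continuous_sphere (by fun_prop)) hcosh (by positivity)
    (by linarith)).trans_eq' ?_
  congr with ω
  have hscale : ∑ i, d * f (ψ i ω) / 1026 - n * ∫ x, d * f x / 1026 ∂(uniformSphere d) =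
      n / 1026 * (d / n * ∑ i, f (ψ i ω) - d * ∫ x, f x ∂(uniformSphere d)) := by
    rw [integral_div, integral_const_mul, ← Finset.sum_div, ← Finset.mul_sum]
    field_simp
  rw [hscale, abs_mul, abs_of_pos (by positivity : (0 : ℝ) < n / 1026), ← mul_div_assoc,
    mul_div_right_comm, mul_le_mul_iff_right₀ (by positivity)]

theorem measureReal_le_abs_povmSeminorm_sub_le (hind : iIndepFun ψ P)
    (hlaw : ∀ i, HasLaw (ψ i) (uniformSphere d) P) {Δ : Matrix (Fin d) (Fin d) ℂ}
    (hΔ : uniformSeminorm d Δ ≤ 1) (hδ₀ : 0 ≤ δ) (hδ : δ ≤ 1) :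
    P.real {ω | δ ≤ |povmSeminorm (empiricalFamily fun i => ψ i ω) Δ - uniformSeminorm d Δ|} ≤
      2 * exp (-(n * (δ / 1026) ^ 2 / 512)) := by
  simp only [povmSeminorm_empiricalFamily, uniformSeminorm_eq]
  exact measureReal_le_abs_mul_sum_sub_integral_le hind hlaw (f := fun x => ‖quadForm Δ x‖)
    (continuous_quadForm_sphere Δ).norm
    (integral_cosh_norm_quadForm_sphere_le_two_of_uniformSeminorm_le_one hΔ) hδ₀ hδ

theorem measureReal_le_defectSeminorm_le (hind : iIndepFun ψ P)
    (hlaw : ∀ i, HasLaw (ψ i) (uniformSphere d) P) {Δ : Matrix (Fin d) (Fin d) ℂ}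
    (hΔ : uniformSeminorm d Δ ≤ 1) (hδ₀ : 0 ≤ δ) (hδ : δ ≤ 1) :
    P.real {ω | δ ≤ defectSeminorm (empiricalFamily fun i => ψ i ω) Δ} ≤
      2 * exp (-(n * (δ / 1026) ^ 2 / 512)) := by
  simp only [defectSeminorm_empiricalFamily, ← integral_re_quadForm_sphere]
  exact measureReal_le_abs_mul_sum_sub_integral_le hind hlaw (f := fun x => (quadForm Δ x).re)
    (Complex.continuous_re.comp (continuous_quadForm_sphere Δ))
    (integral_cosh_re_quadForm_sphere_le_two_of_uniformSeminorm_le_one hΔ) hδ₀ hδ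

theorem exists_isNet_uniformSeminorm_card_le (d : ℕ) [NeZero d] (hδ : 0 < δ) :
    ∃ N, IsNet ((uniformSeminorm d).restrictScalars ℝ) δ N ∧
      (N.card : ℝ) ≤ (1 + 2 / δ) ^ (2 * d ^ 2) := by
  have hker : ∀ Δ, (uniformSeminorm d).restrictScalars ℝ Δ = 0 → Δ = 0 := fun Δ hΔ => by
    have hle : ‖Δ‖ ≤ 512 * (uniformSeminorm d).restrictScalars ℝ Δ :=
      frobenius_norm_le_uniformSeminorm Δ
    rwa [hΔ, mul_zero, norm_le_zero_iff] at hle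
  have hfinrank : Module.finrank ℝ (Matrix (Fin d) (Fin d) ℂ) = 2 * d ^ 2 := by
    rw [Module.finrank_matrix, Fintype.card_fin, Complex.finrank_real_complex]
    ring
  rw [← hfinrank]
  exact exists_isNet_card_le hker hδ

theorem measureReal_not_isDiscretePOVM_and_abs_sub_le (hind : iIndepFun ψ P)
    (hlaw : ∀ i, HasLaw (ψ i) (uniformSphere d) P) (hδ₀ : 0 < δ) (hδ : δ ≤ 1 / 16) :
    P.real {ω | ¬ (IsDiscretePOVM (randomPOVM fun i => ψ i ω) ∧
      ∀ Δ, |povmNorm (randomPOVM fun i => ψ i ω) Δ - uniformNorm d Δ| ≤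
        200000 * δ * uniformNorm d Δ)} ≤
      (1 + 2 / δ) ^ (2 * d ^ 2) * (4 * exp (-(n * (δ / 1026) ^ 2 / 512))) := by
  obtain ⟨N, hN, hcard⟩ := exists_isNet_uniformSeminorm_card_le d hδ₀
  let B (Δ : Matrix (Fin d) (Fin d) ℂ) : Set Ω :=
    {ω | δ ≤ |povmSeminorm (empiricalFamily fun i => ψ i ω) Δ - uniformSeminorm d Δ|} ∪
      {ω | δ ≤ defectSeminorm (empiricalFamily fun i => ψ i ω) Δ}
  have hB : ∀ Δ ∈ N, P.real (B Δ) ≤ 4 * exp (-(n * (δ / 1026) ^ 2 / 512)) := fun Δ hΔ => by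
    have hnorm := measureReal_le_abs_povmSeminorm_sub_le hind hlaw (hN.le_one Δ hΔ) hδ₀.le
      (by linarith)
    have hsum := measureReal_le_defectSeminorm_le hind hlaw (hN.le_one Δ hΔ) hδ₀.le
      (by linarith)
    linarith [measureReal_union_le (μ := P)
      {ω | δ ≤ |povmSeminorm (empiricalFamily fun i => ψ i ω) Δ - uniformSeminorm d Δ|}
      {ω | δ ≤ defectSeminorm (empiricalFamily fun i => ψ i ω) Δ}]
  calc _ ≤ P.real (⋃ Δ ∈ N, B Δ) := by
        refine measureReal_mono (fun ω hω => ?_) (measure_ne_top _ _)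
        by_contra hgood
        simp only [B, Set.mem_iUnion, Set.mem_union, Set.mem_ofPred_eq, not_exists, not_or,
          not_le] at hgood
        refine hω ?_
        rw [← normalized_empiricalFamily]
        exact isDiscretePOVM_normalized_and_abs_sub_le_of_isNet (posSemidef_empiricalFamily _)
          (trace_sum_empiricalFamily _) hN hδ₀.le hδ (fun Δ hΔ => (hgood Δ hΔ).1.le)
          fun Δ hΔ => (hgood Δ hΔ).2.le
    _ ≤ ∑ Δ ∈ N, P.real (B Δ) := measureReal_biUnion_finset_le _ _
    _ ≤ ∑ _Δ ∈ N, 4 * exp (-(n * (δ / 1026) ^ 2 / 512)) := Finset.sum_le_sum hB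
    _ = N.card * (4 * exp (-(n * (δ / 1026) ^ 2 / 512))) := by
        rw [Finset.sum_const, nsmul_eq_mul]
    _ ≤ _ := by gcongr

end UnionBound

section Exponents

variable {ε : ℝ} {d : ℕ}

theorem pow_mul_exp_neg_lt (hε : 0 < ε) {x y : ℝ} (hx₀ : 0 ≤ x) (hx : x ≤ exp 13 / ε)
    (hd : 1 ≤ d) (hy : 64 * max 1 |log ε| * (d : ℝ) ^ 2 ≤ y) :
    x ^ (2 * d ^ 2) * (4 * exp (-y)) < exp (-(y / 64)) := by
  set L := max 1 |log ε|
  have hL : 1 ≤ L := le_max_left _ _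
  have hlog : -log ε ≤ L := (neg_le_abs _).trans (le_max_right _ _)
  have hx_exp : x ≤ exp (14 * L) :=
    calc x ≤ exp 13 / ε := hx
      _ = exp (13 + -log ε) := by rw [exp_add, exp_neg, exp_log hε, div_eq_mul_inv]
      _ ≤ exp (14 * L) := exp_le_exp.2 (by linarith)
  have hfour : 4 ≤ exp 2 := by
    rw [show (2 : ℝ) = 1 + 1 by norm_num, exp_add]
    nlinarith [exp_one_gt_d9]
  have hLd : 1 ≤ L * (d : ℝ) ^ 2 :=
    one_le_mul_of_one_le_of_one_le hL (one_le_pow₀ (by exact_mod_cast hd))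
  calc x ^ (2 * d ^ 2) * (4 * exp (-y))
      ≤ exp (14 * L) ^ (2 * d ^ 2) * (exp 2 * exp (-y)) := by gcongr
    _ = exp (28 * (L * d ^ 2) + (2 - y)) := by
        rw [← exp_nat_mul, ← exp_add, ← exp_add]
        push_cast
        ring_nf
    _ < exp (-(y / 64)) := exp_lt_exp.2 (by linarith)

theorem one_add_two_div_le_exp_div (hε : 0 < ε) (hε₁ : ε < 1) :
    1 + 2 / (ε / 200000) ≤ exp 13 / ε := by
  have hexp : (400001 : ℝ) ≤ exp 13 :=
    calc (400001 : ℝ) ≤ 2.71 ^ 13 := by norm_num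
      _ ≤ exp 1 ^ 13 := by gcongr; linarith [exp_one_gt_d9]
      _ = exp 13 := by rw [← exp_nat_mul]; norm_num
  rw [le_div_iff₀ hε]
  field_simp
  linarith

theorem mul_sq_le_sq_mul_div {C L x : ℝ} (hC : 0 < C) (hε : 0 < ε)
    (h : C * (ε ^ 2)⁻¹ * L * (d : ℝ) ^ 2 ≤ x) : L * (d : ℝ) ^ 2 ≤ ε ^ 2 * x / C := by
  rw [le_div_iff₀ hC]
  calc L * (d : ℝ) ^ 2 * C = ε ^ 2 * (C * (ε ^ 2)⁻¹ * L * d ^ 2) := by field_simp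
    _ ≤ ε ^ 2 * x := by gcongr

theorem le_sq_mul_div {C x : ℝ} (hC : 0 < C) (hε : 0 < ε)
    (h : C * (ε ^ 2)⁻¹ * max 1 |log ε| * (d : ℝ) ^ 2 ≤ x) : (d : ℝ) ≤ ε ^ 2 * x / C :=
  calc (d : ℝ) ≤ (d : ℝ) ^ 2 := by exact_mod_cast Nat.le_self_pow two_ne_zero d
    _ ≤ max 1 |log ε| * (d : ℝ) ^ 2 := le_mul_of_one_le_left (sq_nonneg _) (le_max_left _ _)
    _ ≤ ε ^ 2 * x / C := mul_sq_le_sq_mul_div hC hε h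

end Exponents

end RandomPOVM

end

theorem theorem4p2_general :
    ∃ C : ℝ, 0 < C ∧ ∀ ε : ℝ, 0 < ε → ε < 1 → ∀ d n : ℕ, 1 ≤ d →
      C * (ε ^ 2)⁻¹ * max 1 |Real.log ε| * (d : ℝ) ^ 2 ≤ (n : ℝ) →
      ∀ (Ω : Type*) [MeasurableSpace Ω] (P : MeasureTheory.Measure Ω)
        [MeasureTheory.IsProbabilityMeasure P]
        (ψ : Fin n → Ω → RandomPOVM.UnitSphere d),
        ProbabilityTheory.iIndepFun ψ P →
        (∀ i, ProbabilityTheory.HasLaw (ψ i) (RandomPOVM.uniformSphere d) P) →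
        P.real {ω | ¬ (RandomPOVM.IsDiscretePOVM (RandomPOVM.randomPOVM fun i => ψ i ω) ∧
            ∀ Δ : Matrix (Fin d) (Fin d) ℂ,
              (1 - ε) * RandomPOVM.uniformNorm d Δ
                  ≤ RandomPOVM.povmNorm (RandomPOVM.randomPOVM fun i => ψ i ω) Δ ∧
              RandomPOVM.povmNorm (RandomPOVM.randomPOVM fun i => ψ i ω) Δ
                  ≤ (1 + ε) * RandomPOVM.uniformNorm d Δ)}
          < Real.exp (-(ε ^ 2 * n / C)) := by
  refine ⟨64 * (512 * (1026 * 200000) ^ 2), by norm_num, ?_⟩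
  intro ε hε hε₁ d n hd hn Ω _ P _ ψ hind hlaw
  have : NeZero d := ⟨by omega⟩
  have : NeZero n := ⟨by
    rintro rfl
    exact absurd hn (not_le.2 (by push_cast; positivity))⟩
  have hrate := RandomPOVM.mul_sq_le_sq_mul_div (by norm_num) hε hn
  have hfail := RandomPOVM.measureReal_not_isDiscretePOVM_and_abs_sub_le hind hlaw
    (δ := ε / 200000) (by positivity) (by linarith)
  have hnet := RandomPOVM.pow_mul_exp_neg_lt hε (by positivity)
    (RandomPOVM.one_add_two_div_le_exp_div hε hε₁) hd
    (y := n * (ε / 200000 / 1026) ^ 2 / 512) (by linarith)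
  rw [show n * (ε / 200000 / 1026) ^ 2 / 512 / 64 =
    ε ^ 2 * n / (64 * (512 * (1026 * 200000) ^ 2)) by ring] at hnet
  refine (MeasureTheory.measureReal_mono ?_).trans_lt (hfail.trans_lt hnet)
  refine fun ω hω hgood => hω ⟨hgood.1, fun Δ => ?_⟩
  have hclose := abs_le.1 (hgood.2 Δ)
  constructor <;> linarith

theorem theorem4p2 :
    ∃ C : ℝ, 0 < C ∧ ∀ ε : ℝ, 0 < ε → ε < 1 →
      ∃ c : ℝ, 0 < c ∧ ∀ d n : ℕ, 1 ≤ d →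
        C * (ε ^ 2)⁻¹ * max 1 |Real.log ε| * (d : ℝ) ^ 2 ≤ (n : ℝ) →
        ∀ (Ω : Type*) [MeasurableSpace Ω] (P : MeasureTheory.Measure Ω)
          [MeasureTheory.IsProbabilityMeasure P]
          (ψ : Fin n → Ω → RandomPOVM.UnitSphere d),
          ProbabilityTheory.iIndepFun ψ P →
          (∀ i, ProbabilityTheory.HasLaw (ψ i) (RandomPOVM.uniformSphere d) P) →
          P.real {ω | ¬ (RandomPOVM.IsDiscretePOVM (RandomPOVM.randomPOVM fun i => ψ i ω) ∧
              ∀ Δ : Matrix (Fin d) (Fin d) ℂ, Δ.IsHermitian →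
                (1 - ε) * RandomPOVM.uniformNorm d Δ
                    ≤ RandomPOVM.povmNorm (RandomPOVM.randomPOVM fun i => ψ i ω) Δ ∧
                RandomPOVM.povmNorm (RandomPOVM.randomPOVM fun i => ψ i ω) Δ
                    ≤ (1 + ε) * RandomPOVM.uniformNorm d Δ)}
            < Real.exp (-(c * d)) := by
  obtain ⟨C, hC, h⟩ := theorem4p2_general
  refine ⟨C, hC, fun ε hε hε₁ => ⟨1, one_pos, fun d n hd hn Ω _ P _ ψ hind hlaw => ?_⟩⟩
  have hle := RandomPOVM.le_sq_mul_div hC hε hn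
  refine (MeasureTheory.measureReal_mono ?_).trans_lt
    ((h ε hε hε₁ d n hd hn Ω P ψ hind hlaw).trans_le (Real.exp_le_exp.2 (by linarith)))
  exact fun ω hω hgood => hω ⟨hgood.1, fun Δ _ => hgood.2 Δ⟩
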